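/- Let $n\ge 1$ and $m\ge 0$ be integers. The book with $n-1$ pages consists of $n-1$ copies of the closed upper half-plane, glued along the real line $\mathbb{R}$. An $n$-wave graph with $m$ vertices is a simple graph with the vertices $1,2,\dots,m$, each connected component of which is a path with $n-1$ edges $\{i_1,i_2\},\{i_2,i_3\},\dots,\{i_{n-1},i_n\}$ such that $i_1<i_2<\dots<i_n$, and which can be drawn in the book with $n-1$ pages, with vertex $i$ at the point $i\in\mathbb{R}$, such that for every connected component and every $N=1,\dots,n-1$ the edge $\{i_N,i_{N+1}\}$ is drawn on the $N$-th page, without intersections. (Each edge is drawn as a simple arc joining its endpoints, whose other points lie in the open half-plane of its page; distinct arcs may meet only in common endpoints.) The number of $n$-wave graphs with $m$ vertices is nonzero if and only if $m=kn$ for some integer $k$. In that case it equals $$\frac{m!\,\bigl(1!\,2!\cdots (n-1)!\bigr)}{k!\,(k+1)!\cdots (k+n-1)!}.$$ More precisely, let $m=kn$, and consider the words $\alpha_1\dots\alpha_m$ in the alphabet $\{1,\dots,n\}$ that contain exactly $k$ copies of each letter and are lattice words, which means that every initial segment contains at least as many $1$'s as $2$'s, at least as many $2$'s as $3$'s, and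 so on. Then: (a) there is a bijection from the set of $n$-wave graphs with $m$ vertices onto the set of these words, which sends a graph to the word with $\alpha_{i_N}=N$ for every connected component $i_1<i_2<\dots<i_n$ and every $N=1,\dots,n$; (b) there is a bijection from the set of standard Young tableaux of the rectangular shape $n^k$ ($k$ rows of length $n$) onto the set of these words, which sends a tableau to the word in which $\alpha_i$ is the number of the column that contains the entry $i$. -/

import Mathlib

open scoped Nat

/-- The point of the real line, seen as the boundary of the upper half-plane in `ℂ`, at which the
vertex `i` is placed. The vertices `1, …, m` are the elements `0, …, m - 1` of `Fin m`. -/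
noncomputable def vertexPoint {m : ℕ} (i : Fin m) : ℂ := ((i : ℕ) : ℂ) + 1

/-- A drawing of a graph with vertices `1, …, m` in the book with `K` pages, that is, in `K` copies
of the closed upper half-plane glued along the real line. The vertices are placed at the points
`1, …, m` of the real line. Each edge is drawn on one page, as a simple arc which joins its two
endpoints and whose other points lie in the open half-plane. The arcs do not intersect, except in
common endpoints. (Two different pages have only the real line in common, so that arcs on different
pages can only meet in common endpoints, and only arcs on the same page have to be compared.) -/
structure BookDrawing {m : ℕ} (G : SimpleGraph (Fin m)) (K : ℕ) where
  /-- the page on which an edge is drawn -/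
  page : G.edgeSet → Fin K
  /-- the arc in the page by which an edge is drawn -/
  arc : G.edgeSet → C(unitInterval, ℂ)
  arc_injective : ∀ e, Function.Injective (arc e)
  arc_ends : ∀ e, s(arc e 0, arc e 1) = Sym2.map vertexPoint (e : Sym2 (Fin m))
  arc_interior : ∀ e, ∀ t ∈ Set.Ioo (0 : unitInterval) 1, 0 < (arc e t).im
  no_intersection : ∀ e f, e ≠ f → page e = page f →
    ∀ s ∈ Set.Ioo (0 : unitInterval) 1, ∀ t ∈ Set.Ioo (0 : unitInterval) 1, arc e s ≠ arc f t

/-- `p` lists the vertices `i₁, i₂, …, iₙ` of the connected component `c` along a path with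
`n - 1` edges, which is the whole component, and `i₁ < i₂ < … < iₙ`. -/
def IsWave {m n : ℕ} {G : SimpleGraph (Fin m)} (c : G.ConnectedComponent)
    (p : SimpleGraph.pathGraph n ≃g c.toSimpleGraph) : Prop :=
  StrictMono fun a : Fin n => (p a : Fin m)

/-- `n`-wave graphs on the vertices `1, …, m`: each connected component is a path
`i₁ < i₂ < … < iₙ`, and the graph can be drawn in the book with `n - 1` pages such that the
edge `{i_N, i_{N+1}}` of each component is drawn on the `N`-th page. (Positions in a path and pages
are numbered from `0` in the code.) -/
def IsWaveGraph (n : ℕ) {m : ℕ} (G : SimpleGraph (Fin m)) : Prop :=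
  ∃ wave : ∀ c : G.ConnectedComponent, SimpleGraph.pathGraph n ≃g c.toSimpleGraph,
    (∀ c, IsWave c (wave c)) ∧
    ∃ D : BookDrawing G (n - 1), ∀ (c : G.ConnectedComponent) (a b : Fin n) (e : G.edgeSet),
      (a : ℕ) + 1 = b → (e : Sym2 (Fin m)) = s((wave c a : Fin m), (wave c b : Fin m)) →
        (D.page e : ℕ) = a

/-- The set of `n`-wave graphs with `m` vertices. -/
def WaveGraph (n m : ℕ) : Type := {G : SimpleGraph (Fin m) // IsWaveGraph n G}

/-- Lattice words of length `m` in the alphabet `{1, …, n}` (the letters are numbered from `0` in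
the code): each initial part contains at least as many 1's as 2's, at least as many 2's as 3's,
and so on. -/
def IsLatticeWord {n m : ℕ} (w : Fin m → Fin n) : Prop :=
  ∀ (i : Fin m) (a b : Fin n), (a : ℕ) + 1 = b →
    (Finset.univ.filter fun j => j ≤ i ∧ w j = b).card ≤
      (Finset.univ.filter fun j => j ≤ i ∧ w j = a).card

/-- Lattice words of length `m` that contain exactly `k` copies of each letter `1, …, n`. -/
def BalancedLatticeWord (n k m : ℕ) : Type :=
  {w : Fin m → Fin n // IsLatticeWord w ∧
    ∀ a : Fin n, (Finset.univ.filter fun j => w j = a).card = k}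

/-- The Young diagram of the partition `n^k`, with `k` rows of length `n`. -/
def rectDiagram (n k : ℕ) : YoungDiagram where
  cells := Finset.range k ×ˢ Finset.range n
  isLowerSet := by
    rintro ⟨i, j⟩ ⟨i', j'⟩ h hij
    obtain ⟨h1, h2⟩ := Prod.mk_le_mk.mp h
    simp only [Finset.coe_product, Finset.coe_range, Set.mem_prod, Set.mem_Iio] at hij ⊢
    omega

/-- Standard Young tableaux of shape `μ`: each of the numbers `1, …, |μ|` is written in exactly one
cell, and the entries increase along rows and columns. (They increase strictly along rows since
they are distinct.) -/
def StandardTableau (μ : YoungDiagram) : Type :=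
  {T : SemistandardYoungTableau μ //
    Set.BijOn (fun c : ℕ × ℕ => T c.1 c.2) μ.cells (Set.Icc 1 μ.card)}

/-! An `n`-wave graph is encoded by the word of the positions of its vertices in their components.
The edges on one page join the letters `a` to later letters `a + 1`, so each page carries a perfect
matching of these two letters, and drawability makes it noncrossing. Two arcs in the closed
half-plane with interlacing endpoints must meet (`exists_eq_of_interlacing`); conversely, parabolas
over nested or disjoint segments do not meet (`parabolaArc_ne`). Hence the drawing condition is
purely combinatorial.

Read `a` as an opening and `a + 1` as a closing parenthesis. A balanced lattice word has such a
matching for every `a` (`isMatching_matches`), a word with such matchings is a lattice word, and the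
matching is forced to be the usual parenthesis matching (`IsMatching.iff_matches`). Chains of
partners recover the paths, so graph and word determine each other.

For tableaux, column `c` lists in increasing order the places of the letter `c`; weak increase along
rows is the lattice condition.

For the count, removing the last letter expresses the number of lattice words of content `μ` as a
sum over the contents with one letter fewer. The number `m! det(1 / (μ i - i + j)!)` satisfies the
same recursion, by multilinearity of the determinant (`sum_det_updateRow_sub_mul`), and for constant
`μ` the determinant reduces to a Vandermonde determinant. -/

/-! ### Arcs in the half-plane with interlacing endpoints -/

/-- Two continuous branches of the argument differ by a constant: along a path in the closed upper
half-plane, the imaginary part of a continuous logarithm changes as `Complex.arg` does. -/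
lemma im_sub_im_eq_arg_sub_arg {F f : unitInterval → ℂ} (hF : Continuous F) (hf : Continuous f)
    (h : ∀ t, Complex.exp (F t) = f t) (him : ∀ t, 0 ≤ (f t).im) :
    (F 1).im - (F 0).im = Complex.arg (f 1) - Complex.arg (f 0) := by
  have harg : Continuous fun t => Complex.arg (f t) := by
    rw [continuous_iff_continuousAt]
    intro t
    have h0 : f t ≠ 0 := h t ▸ Complex.exp_ne_zero _
    by_cases hs : f t ∈ Complex.slitPlane
    · exact (Complex.continuousAt_arg hs).comp hf.continuousAt
    · rw [Complex.mem_slitPlane_iff, not_or, not_lt, not_not] at hs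
      have hre : (f t).re < 0 := lt_of_le_of_ne hs.1 fun hr => h0 (Complex.ext hr hs.2)
      -- On the negative real axis `arg` jumps, but it is continuous from within the closed upper
      -- half-plane, where `f` stays.
      have := Complex.continuousWithinAt_arg_of_re_neg_of_im_zero hre hs.2
      have h2 : Filter.Tendsto f (nhds t) (nhdsWithin (f t) {z : ℂ | 0 ≤ z.im}) :=
        tendsto_nhdsWithin_iff.mpr ⟨hf.continuousAt, Filter.Eventually.of_forall him⟩
      exact Filter.Tendsto.comp this h2
  have hn : ∀ t, ∃ n : ℤ, (n : ℝ) = ((F t).im - Complex.arg (f t)) / (2 * Real.pi) := by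
    intro t
    have h0 : f t ≠ 0 := h t ▸ Complex.exp_ne_zero _
    have : Complex.exp (F t) = Complex.exp (Complex.log (f t)) := by
      rw [h, Complex.exp_log h0]
    obtain ⟨n, hn⟩ := Complex.exp_eq_exp_iff_exists_int.mp this
    refine ⟨n, ?_⟩
    rw [hn, eq_div_iff (by positivity)]
    simp [Complex.log_im]
  choose n hn using hn
  have hcont : Continuous n := by
    rw [Int.isClosedEmbedding_coe_real.isEmbedding.continuous_iff]
    have : ((↑) : ℤ → ℝ) ∘ n = fun t => ((F t).im - Complex.arg (f t)) / (2 * Real.pi) := by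
      funext t; exact hn t
    rw [this]
    exact ((Complex.continuous_im.comp hF).sub harg).div_const _
  -- An integer-valued continuous function on the interval is constant.
  have h01 : n 1 = n 0 := PreconnectedSpace.constant inferInstance hcont
  have h1 := hn 1
  rw [h01, hn 0, div_left_inj' (by positivity)] at h1
  linarith

/-- Adding `πi` to the logarithm negates the path and so moves it to the upper half-plane. -/
lemma im_sub_im_eq_arg_neg_sub_arg_neg {F f : unitInterval → ℂ} (hF : Continuous F)
    (hf : Continuous f) (h : ∀ t, Complex.exp (F t) = f t) (him : ∀ t, (f t).im ≤ 0) :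
    (F 1).im - (F 0).im = Complex.arg (-f 1) - Complex.arg (-f 0) := by
  have := im_sub_im_eq_arg_sub_arg (F := fun t => F t + Real.pi * Complex.I) (f := fun t => -f t)
    (by fun_prop) (by fun_prop) (fun t => by rw [Complex.exp_add, h]; simp)
    (fun t => by simpa using him t)
  simpa using this

/-- Two paths in the closed upper half-plane whose endpoints interlace on the real line meet. -/
lemma exists_eq_of_interlacing {γ δ : C(unitInterval, ℂ)} {a b c d : ℝ} (hab : a < b) (hbc : b < c)
    (hcd : c < d) (hγ0 : γ 0 = a) (hγ1 : γ 1 = c) (hδ0 : δ 0 = b) (hδ1 : δ 1 = d)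
    (hγ : ∀ t, 0 ≤ (γ t).im) (hδ : ∀ t, 0 ≤ (δ t).im) : ∃ s t, γ s = δ t := by
  by_contra! hne
  -- Composing with the projection onto the square extends `γ s - δ t` to the whole plane, an open
  -- simply connected set, so that it has a continuous logarithm `L` there.
  let pr : ℝ → unitInterval := Set.projIcc 0 1 zero_le_one
  have hpr : Continuous pr := continuous_projIcc
  have hprc : ∀ t : unitInterval, pr t = t := fun t => Set.projIcc_val zero_le_one t
  have hsc : IsSimplyConnected (Set.univ : Set (ℝ × ℝ)) := by
    have := convex_univ.contractibleSpace (Set.univ_nonempty (α := ℝ × ℝ))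
    exact SimplyConnectedSpace.ofContractible _
  obtain ⟨L, hLc, hL⟩ := Complex.exists_continuousOn_eqOn_exp_comp
    (U := (Set.univ : Set (ℝ × ℝ))) (g := fun p => γ (pr p.1) - δ (pr p.2))
    hsc isOpen_univ
    (Continuous.continuousOn (by fun_prop))
    (by rintro ⟨p, -, hp⟩; exact hne _ _ (sub_eq_zero.mp hp))
  rw [continuousOn_univ] at hLc
  have hL' : ∀ s t : unitInterval, Complex.exp (L (s, t)) = γ s - δ t := by
    intro s t
    have := hL (Set.mem_univ ((s : ℝ), (t : ℝ)))
    simpa only [Function.comp, hprc] using this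
  have arg_pos : ∀ {x y : ℝ}, x < y → Complex.arg ((y : ℂ) - x) = 0 := by
    intro x y h
    rw [← Complex.ofReal_sub, Complex.arg_ofReal_of_nonneg (by linarith)]
  have arg_neg : ∀ {x y : ℝ}, x < y → Complex.arg ((x : ℂ) - y) = Real.pi := by
    intro x y h
    rw [← Complex.ofReal_sub, Complex.arg_ofReal_of_neg (by linarith)]
  have e1 := im_sub_im_eq_arg_sub_arg (F := fun s => L (s, (0 : unitInterval)))
    (f := fun s => γ s - δ 0) (by fun_prop) (by fun_prop) (fun s => hL' s 0)
    (fun s => by simpa [hδ0] using hγ s)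
  have e2 := im_sub_im_eq_arg_neg_sub_arg_neg (F := fun t => L ((1 : unitInterval), t))
    (f := fun t => γ 1 - δ t) (by fun_prop) (by fun_prop) (fun t => hL' 1 t)
    (fun t => by simpa [hγ1] using hδ t)
  have e3 := im_sub_im_eq_arg_sub_arg (F := fun s => L (s, (1 : unitInterval)))
    (f := fun s => γ s - δ 1) (by fun_prop) (by fun_prop) (fun s => hL' s 1)
    (fun s => by simpa [hδ1] using hγ s)
  have e4 := im_sub_im_eq_arg_neg_sub_arg_neg (F := fun t => L ((0 : unitInterval), t))
    (f := fun t => γ 0 - δ t) (by fun_prop) (by fun_prop) (fun t => hL' 0 t)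
    (fun t => by simpa [hγ0] using hδ t)
  -- From the corner `(0, 0)` to `(1, 1)` the imaginary part of `L` changes by `-π - π` via `(1,
  -- 0)`, but by `0 + 0` via `(0, 1)`.
  simp only [hγ0, hγ1, hδ0, hδ1, neg_sub] at e1 e2 e3 e4
  rw [arg_pos hbc, arg_neg hab] at e1
  rw [arg_pos hcd, arg_neg hbc] at e2
  rw [arg_neg hcd, arg_neg (hab.trans (hbc.trans hcd))] at e3
  rw [arg_pos (hab.trans (hbc.trans hcd)), arg_pos hab] at e4
  have := Real.pi_pos
  linarith

/-! ### Parabolas as noncrossing arcs -/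

/-- The parabola arc over the segment from `a` to `b`. -/
noncomputable def parabolaArc (a b : ℝ) : C(unitInterval, ℂ) where
  toFun t := ⟨a + t * (b - a), (t * (b - a)) * ((1 - t) * (b - a))⟩
  continuous_toFun := by
    simp only [Complex.mk_eq_add_mul_I]
    fun_prop

lemma parabolaArc_injective {a b : ℝ} (h : a ≠ b) : Function.Injective (parabolaArc a b) := by
  intro s t hst
  have := congrArg Complex.re hst
  simp only [parabolaArc, ContinuousMap.coe_mk, add_right_inj, mul_eq_mul_right_iff, sub_eq_zero,
    h.symm, or_false] at this
  exact Subtype.ext this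

lemma parabolaArc_zero (a b : ℝ) : parabolaArc a b 0 = a := by
  apply Complex.ext <;> simp [parabolaArc]

lemma parabolaArc_one (a b : ℝ) : parabolaArc a b 1 = b := by
  apply Complex.ext <;> simp [parabolaArc]

lemma parabolaArc_im_pos {a b : ℝ} (h : a < b) {t : unitInterval} (ht : t ∈ Set.Ioo 0 1) :
    0 < (parabolaArc a b t).im := by
  have h0 : (0 : ℝ) < t := ht.1
  have h1 : (0 : ℝ) < 1 - t := sub_pos.mpr ht.2
  have : 0 < b - a := sub_pos.mpr h
  simp only [parabolaArc, ContinuousMap.coe_mk]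
  positivity

lemma parabolaArc_eq {a b : ℝ} (h : a < b) {t : unitInterval} (ht : t ∈ Set.Ioo 0 1) :
    a < (parabolaArc a b t).re ∧ (parabolaArc a b t).re < b ∧ (parabolaArc a b t).im =
      ((parabolaArc a b t).re - a) * (b - (parabolaArc a b t).re) := by
  have h0 : (0 : ℝ) < t := ht.1
  have h1 : (0 : ℝ) < 1 - t := sub_pos.mpr ht.2
  have h2 : 0 < b - a := sub_pos.mpr h
  simp only [parabolaArc, ContinuousMap.coe_mk]
  refine ⟨by nlinarith, by nlinarith, by ring⟩

/-- Parabola arcs over nested or over disjoint segments do not meet. -/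
lemma parabolaArc_ne {a b c d : ℝ} (hab : a < b) (hcd : c < d)
    (h : (a < c ∧ d < b) ∨ (c < a ∧ b < d) ∨ b < c ∨ d < a) {s t : unitInterval}
    (hs : s ∈ Set.Ioo 0 1) (ht : t ∈ Set.Ioo 0 1) : parabolaArc a b s ≠ parabolaArc c d t := by
  intro heq
  obtain ⟨h1, h2, h3⟩ := parabolaArc_eq hab hs
  obtain ⟨h4, h5, h6⟩ := parabolaArc_eq hcd ht
  rw [heq] at h1 h2 h3
  rw [h3] at h6
  generalize (parabolaArc c d t).re = x at *
  rcases h with h | h | h | h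
  · nlinarith
  · nlinarith
  · linarith
  · linarith

/-! ### Lattice words and parenthesis matchings -/

section Matching

variable {n m : ℕ}

/-- The number of occurrences of the letter `a` among the first `x` letters of `w`. -/
def prefixCount (w : Fin m → Fin n) (a x : ℕ) : ℕ :=
  (Finset.univ.filter fun j : Fin m => (j : ℕ) < x ∧ (w j : ℕ) = a).card

lemma prefixCount_zero (w : Fin m → Fin n) (a : ℕ) : prefixCount w a 0 = 0 := by
  simp [prefixCount]

lemma prefixCount_add (w : Fin m → Fin n) (a : ℕ) {x y : ℕ} (h : x ≤ y) :
    prefixCount w a y = prefixCount w a x +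
      (Finset.univ.filter fun j : Fin m => x ≤ (j : ℕ) ∧ (j : ℕ) < y ∧ (w j : ℕ) = a).card := by
  rw [prefixCount, prefixCount, ← Finset.card_union_of_disjoint]
  · congr 1
    ext j
    simp only [Finset.mem_filter, Finset.mem_univ, true_and, Finset.mem_union]
    omega
  · rw [Finset.disjoint_filter]
    intro j _
    omega

lemma prefixCount_succ (w : Fin m → Fin n) (a : ℕ) (j : Fin m) :
    prefixCount w a (j + 1) = prefixCount w a j + if (w j : ℕ) = a then 1 else 0 := by
  rw [prefixCount_add w a (Nat.le_succ j)]
  congr 1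
  split_ifs with h
  · rw [Finset.card_eq_one]
    refine ⟨j, Finset.ext fun i => ?_⟩
    simp only [Finset.mem_filter, Finset.mem_univ, true_and, Finset.mem_singleton, Fin.ext_iff]
    constructor
    · omega
    · intro hi
      have : i = j := Fin.ext hi
      subst this
      omega
  · rw [Finset.card_eq_zero, Finset.filter_eq_empty_iff]
    rintro i - ⟨h1, h2, h3⟩
    have : i = j := Fin.ext (by omega)
    exact h (this ▸ h3)

lemma prefixCount_mono (w : Fin m → Fin n) (a : ℕ) {x y : ℕ} (h : x ≤ y) :
    prefixCount w a x ≤ prefixCount w a y := by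
  rw [prefixCount_add w a h]; omega

lemma prefixCount_of_le (w : Fin m → Fin n) {a : ℕ} (ha : n ≤ a) (x : ℕ) :
    prefixCount w a x = 0 := by
  rw [prefixCount, Finset.card_eq_zero, Finset.filter_eq_empty_iff]
  rintro i - ⟨_, h⟩
  have := (w i).2
  omega

lemma prefixCount_length (w : Fin m → Fin n) (a : Fin n) :
    prefixCount w a m = (Finset.univ.filter fun j => w j = a).card := by
  simp [prefixCount, Fin.ext_iff]

lemma prefixCount_of_length_le (w : Fin m → Fin n) (a : ℕ) {x : ℕ} (h : m ≤ x) :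
    prefixCount w a x = prefixCount w a m := by
  rw [prefixCount, prefixCount]
  congr 1
  ext j
  simp only [Finset.mem_filter, Finset.mem_univ, true_and]
  omega

/-- Letters beyond the alphabet have count zero and counts are constant beyond the end of the word,
so `a` and `x` may range over all of `ℕ`. -/
lemma isLatticeWord_iff_prefixCount {w : Fin m → Fin n} :
    IsLatticeWord w ↔ ∀ a x, prefixCount w (a + 1) x ≤ prefixCount w a x := by
  have key : ∀ (i : Fin m) (a : Fin n),
      (Finset.univ.filter fun j => j ≤ i ∧ w j = a).card = prefixCount w a (i + 1) := by
    intro i a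
    simp only [prefixCount, Fin.ext_iff, Fin.le_def, Nat.lt_succ_iff]
  constructor
  · intro h a x
    by_cases ha : n ≤ a + 1
    · rw [prefixCount_of_le w ha]; omega
    · have main : ∀ x ≤ m, prefixCount w (a + 1) x ≤ prefixCount w a x := by
        intro x hx
        rcases x with _ | x
        · simp [prefixCount_zero]
        · have := h ⟨x, hx⟩ ⟨a, by omega⟩ ⟨a + 1, by omega⟩ rfl
          rwa [key, key] at this
      rcases le_total x m with hx | hx
      · exact main x hx
      · rw [prefixCount_of_length_le w _ hx, prefixCount_of_length_le w _ hx]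
        exact main m le_rfl
  · intro h i a b hab
    rw [key, key, ← hab]
    exact h a (i + 1)

/-- The surplus of the letter `a` over the letter `a + 1` among the first `x` letters of `w`. -/
def surplus (w : Fin m → Fin n) (a x : ℕ) : ℤ := prefixCount w a x - prefixCount w (a + 1) x

lemma surplus_succ (w : Fin m → Fin n) (a : ℕ) (j : Fin m) :
    surplus w a (j + 1) = surplus w a j + (if (w j : ℕ) = a then 1 else 0) -
      if (w j : ℕ) = a + 1 then 1 else 0 := by
  rw [surplus, surplus, prefixCount_succ, prefixCount_succ]
  push_cast
  ring

/-- If every letter `a` is read as an opening parenthesis and every letter `a + 1` as a closing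
one, then the parentheses at `u` and `v` match each other, where `a` is the letter at `u`. -/
def Matches (w : Fin m → Fin n) (u v : Fin m) : Prop :=
  u < v ∧ (w v : ℕ) = w u + 1 ∧ surplus w (w u) (v + 1) = surplus w (w u) u ∧
    ∀ l : ℕ, (u : ℕ) < l → l ≤ v → surplus w (w u) u < surplus w (w u) l

/-- Both surpluses at `u` and `u'` equal the one after `v`, but the later of the two places lies
strictly above the level of the earlier one. -/
lemma Matches.left_unique {w : Fin m → Fin n} {u u' v : Fin m} (h : Matches w u v)
    (h' : Matches w u' v) : u = u' := by
  wlog hlt : u < u' generalizing u u'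
  · rcases lt_trichotomy u u' with hl | hl | hl
    · exact this h h' hl
    · exact hl
    · exact (this h' h hl).symm
  obtain ⟨h1, h2, h3, h4⟩ := h
  obtain ⟨h1', h2', h3', h4'⟩ := h'
  have hw : (w u : ℕ) = w u' := by omega
  rw [← hw] at h3' h4'
  have := h4 u' hlt (le_of_lt h1')
  omega

lemma Matches.right_unique {w : Fin m → Fin n} {u v v' : Fin m} (h : Matches w u v)
    (h' : Matches w u v') : v = v' := by
  wlog hlt : v < v' generalizing v v'
  · rcases lt_trichotomy v v' with hl | hl | hl
    · exact this h h' hl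
    · exact hl
    · exact (this h' h hl).symm
  obtain ⟨h1, h2, h3, h4⟩ := h
  obtain ⟨h1', h2', h3', h4'⟩ := h'
  have h1 : (u : ℕ) < v := h1
  have := h4' (v + 1) (by omega) hlt
  omega

lemma Matches.not_interlacing {w : Fin m → Fin n} {u v u' v' : Fin m} (h : Matches w u v)
    (h' : Matches w u' v') (hw : w u = w u') (h1 : u < u') (h2 : u' < v) (h3 : v < v') : False := by
  have e1 := h.2.2.2 u' h1 h2.le
  have e2 := h.2.2.1
  have h2 : (u' : ℕ) < v := h2
  have e3 := h'.2.2.2 (v + 1) (by omega) h3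
  rw [← hw] at e3
  omega

/-- The partner is where the surplus first returns to its level at `u`. It does return, because
equal totals bring it to zero at the end and it is never negative. -/
lemma exists_matches_right {w : Fin m → Fin n} (hw : IsLatticeWord w) (u : Fin m)
    (hu : prefixCount w (w u) m = prefixCount w (w u + 1) m) : ∃ v, Matches w u v := by
  rw [isLatticeWord_iff_prefixCount] at hw
  set H := surplus w (w u) with hH
  have hex : ∃ l, (u : ℕ) < l ∧ l ≤ m ∧ H l ≤ H u := by
    refine ⟨m, u.2, le_rfl, ?_⟩
    have := hw (w u) u
    simp only [hH, surplus]
    omega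
  classical
  obtain ⟨h1, h2, h3⟩ := Nat.find_spec hex
  have hmin : ∀ l, (u : ℕ) < l → l < Nat.find hex → H u < H l := by
    intro l hl hl'
    have := Nat.find_min hex hl'
    push Not at this
    exact this hl (by omega)
  generalize Nat.find hex = x at *
  obtain ⟨v, rfl⟩ : ∃ v, x = v + 1 := ⟨x - 1, by omega⟩
  have hstep := surplus_succ w (w u) ⟨v, h2⟩
  have hstepu := surplus_succ w (w u) u
  simp only [← hH] at hstep hstepu
  -- The return is not immediate, since the letter at `u` has just raised the surplus.
  have huv : (u : ℕ) < v := by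
    rcases eq_or_lt_of_le (Nat.lt_succ_iff.mp h1) with he | hl
    · rw [← he] at h3
      simp at hstepu
      omega
    · exact hl
  have := hmin v huv (by omega)
  refine ⟨⟨v, h2⟩, huv, ?_, ?_, fun l hl hl' => hmin l hl (Nat.lt_succ_iff.mpr hl')⟩
  · by_contra hne
    simp only [hne, if_false] at hstep
    split_ifs at hstep <;> omega
  · simp only [← hH]
    split_ifs at hstep <;> omega

/-- The partner is at the last place up to `v` where the surplus does not exceed its value after
`v`. The start of the word is such a place by the lattice condition. -/
lemma exists_matches_left {w : Fin m → Fin n} (hw : IsLatticeWord w) (v : Fin m)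
    (hv : 0 < (w v : ℕ)) : ∃ u, Matches w u v := by
  rw [isLatticeWord_iff_prefixCount] at hw
  obtain ⟨a, ha⟩ : ∃ a, (w v : ℕ) = a + 1 := ⟨w v - 1, by omega⟩
  set H := surplus w a with hH
  have hstepv := surplus_succ w a v
  simp only [← hH, ha] at hstepv
  simp at hstepv
  classical
  let P : ℕ → Prop := fun l => l ≤ v ∧ H l ≤ H (v + 1)
  have h0 : P 0 := by
    refine ⟨by omega, ?_⟩
    have := hw a (v + 1)
    simp only [hH, surplus, prefixCount_zero]
    omega
  have hspec : P (Nat.findGreatest P v) := Nat.findGreatest_spec (Nat.zero_le _) h0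
  have hmax : ∀ l, Nat.findGreatest P v < l → l ≤ v → H (v + 1) < H l := by
    intro l hl hl'
    have := Nat.findGreatest_is_greatest hl hl'
    by_contra hcon
    exact this ⟨hl', by omega⟩
  generalize Nat.findGreatest P v = x at *
  obtain ⟨h1, h2⟩ := hspec
  have hxv : x < v := by
    rcases eq_or_lt_of_le h1 with he | hl
    · subst he; omega
    · exact hl
  have hstep := surplus_succ w a ⟨x, by omega⟩
  simp only [← hH] at hstep
  have h3 := hmax (x + 1) (by omega) hxv
  have hwx : (w ⟨x, by omega⟩ : ℕ) = a := by
    by_contra hne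
    simp only [hne, if_false] at hstep
    split_ifs at hstep <;> omega
  simp only [hwx] at hstep
  simp at hstep
  refine ⟨⟨x, by omega⟩, hxv, by omega, ?_, ?_⟩
  · rw [hwx, ← hH]; simp only; omega
  · rw [hwx, ← hH]
    intro l hl hl'
    have := hmax l hl hl'
    simp only
    omega

/-- A family of noncrossing perfect matchings of the occurrences of each letter `a < n - 1` with the
occurrences of the letter `a + 1` in the word `w`, where partners are in increasing order. -/
structure IsMatching (w : Fin m → Fin n) (R : Fin m → Fin m → Prop) : Prop where
  lt : ∀ {u v}, R u v → u < v
  letter : ∀ {u v}, R u v → (w v : ℕ) = w u + 1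
  left_unique : ∀ {u u' v}, R u v → R u' v → u = u'
  right_unique : ∀ {u v v'}, R u v → R u v' → v = v'
  exists_right : ∀ u, (w u : ℕ) + 1 < n → ∃ v, R u v
  exists_left : ∀ v, 0 < (w v : ℕ) → ∃ u, R u v
  not_interlacing : ∀ {u v u' v'}, R u v → R u' v' → w u = w u' → u < u' → u' < v → v < v' → False

/-- Sending each `a + 1` to its partner `a` on the left is injective on every prefix. -/
lemma IsMatching.isLatticeWord {w : Fin m → Fin n} {R : Fin m → Fin m → Prop}
    (h : IsMatching w R) : IsLatticeWord w := by
  rw [isLatticeWord_iff_prefixCount]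
  intro a x
  have : ∀ v, ∃ u, 0 < (w v : ℕ) → R u v := by
    intro v
    by_cases hv : 0 < (w v : ℕ)
    · obtain ⟨u, hu⟩ := h.exists_left v hv
      exact ⟨u, fun _ => hu⟩
    · exact ⟨v, fun h => absurd h hv⟩
  choose p hp using this
  refine Finset.card_le_card_of_injOn p ?_ ?_
  · intro v hv
    simp only [Finset.coe_filter, Finset.mem_univ, true_and, Set.mem_ofPred_eq] at hv ⊢
    have hR := hp v (by omega)
    have h1 : (p v : ℕ) < v := h.lt hR
    have h2 := h.letter hR
    omega
  · intro v hv v' hv' he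
    simp only [Finset.coe_filter, Finset.mem_univ, true_and, Set.mem_ofPred_eq] at hv hv'
    exact h.right_unique (hp v (by omega)) (he ▸ hp v' (by omega))

/-- This is uniqueness of the noncrossing matching. For a cut strictly after `u` and up to `v`,
every `a + 1` between `u` and the cut has its partner there too, and that partner is not `u`; so the
surplus is strictly above its level at `u`. Up to and including `v`, every `a` after `u` has its
partner in the same stretch, so the surplus has returned. -/
lemma IsMatching.matches {w : Fin m → Fin n} {R : Fin m → Fin m → Prop}
    (h : IsMatching w R) {u v : Fin m} (huv : R u v) : Matches w u v := by
  have hlt : (u : ℕ) < v := h.lt huv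
  have hl := h.letter huv
  set a : ℕ := (w u).val with ha
  have hpos : ∀ l : ℕ, (u : ℕ) < l → l ≤ v → surplus w a u < surplus w a l := by
    intro l hul hlv
    have : ∀ y, ∃ x, 0 < (w y : ℕ) → R x y := by
      intro y
      by_cases hy : 0 < (w y : ℕ)
      · obtain ⟨x, hx⟩ := h.exists_left y hy
        exact ⟨x, fun _ => hx⟩
      · exact ⟨y, fun h => absurd h hy⟩
    choose p hp using this
    rw [surplus, surplus, prefixCount_add w a hul.le, prefixCount_add w (a + 1) hul.le]
    set S := Finset.univ.filter fun j : Fin m => (u : ℕ) ≤ j ∧ (j : ℕ) < l ∧ (w j : ℕ) = a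
    have hu : u ∈ S := by simp [S, hul, ha]
    have hcard : (Finset.univ.filter fun j : Fin m =>
        (u : ℕ) ≤ j ∧ (j : ℕ) < l ∧ (w j : ℕ) = a + 1).card ≤ (S.erase u).card := by
      refine Finset.card_le_card_of_injOn p ?_ ?_
      · intro y hy
        simp only [Finset.coe_filter, Finset.mem_univ, true_and, Set.mem_ofPred_eq] at hy
        have hR := hp y (by omega)
        have h1 : (p y : ℕ) < y := h.lt hR
        have h2 := h.letter hR
        have hne : p y ≠ u := by
          intro he
          have : y = v := h.right_unique (he ▸ hR) huv
          subst this
          omega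
        -- A partner to the left of `u` would make the pairs `(p y, y)` and `(u, v)` interlace.
        have hge : (u : ℕ) ≤ p y := by
          by_contra hcon
          have huy : (u : ℕ) < y := by
            rcases eq_or_lt_of_le hy.1 with he | hl
            · rw [Fin.ext he] at ha; omega
            · exact hl
          refine h.not_interlacing hR huv (Fin.ext (by omega)) (Fin.lt_def.mpr (by omega))
            huy (Fin.lt_def.mpr (by omega))
        simp only [S, Finset.coe_erase, Finset.coe_filter, Finset.mem_univ, true_and,
          Set.mem_sdiff, Set.mem_ofPred_eq, Set.mem_singleton_iff]
        exact ⟨by omega, hne⟩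
      · intro y hy y' hy' he
        simp only [Finset.coe_filter, Finset.mem_univ, true_and, Set.mem_ofPred_eq] at hy hy'
        exact h.right_unique (hp y (by omega)) (he ▸ hp y' (by omega))
    rw [Finset.card_erase_of_mem hu] at hcard
    have := Finset.card_pos.mpr ⟨u, hu⟩
    push_cast
    omega
  refine ⟨hlt, hl, ?_, hpos⟩
  have hge := hpos v hlt le_rfl
  have hstep := surplus_succ w a v
  simp [hl] at hstep
  have hle : surplus w a (v + 1) ≤ surplus w a u := by
    have : ∀ y, ∃ x, (w y : ℕ) = a → R y x := by
      intro y
      by_cases hy : (w y : ℕ) = a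
      · obtain ⟨x, hx⟩ := h.exists_right y (by have := (w v).2; omega)
        exact ⟨x, fun _ => hx⟩
      · exact ⟨y, fun h => absurd h hy⟩
    choose p hp using this
    have huv1 : (u : ℕ) ≤ v + 1 := by omega
    rw [surplus, surplus, prefixCount_add w a huv1, prefixCount_add w (a + 1) huv1]
    have hcard : (Finset.univ.filter fun j : Fin m =>
        (u : ℕ) ≤ j ∧ (j : ℕ) < v + 1 ∧ (w j : ℕ) = a).card ≤ (Finset.univ.filter fun j : Fin m =>
        (u : ℕ) ≤ j ∧ (j : ℕ) < v + 1 ∧ (w j : ℕ) = a + 1).card := by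
      refine Finset.card_le_card_of_injOn p ?_ ?_
      · intro y hy
        simp only [Finset.coe_filter, Finset.mem_univ, true_and, Set.mem_ofPred_eq] at hy ⊢
        have hR := hp y hy.2.2
        have h1 : (y : ℕ) < p y := h.lt hR
        have h2 := h.letter hR
        refine ⟨by omega, ?_, by omega⟩
        by_contra hcon
        have hvp : v < p y := Fin.lt_def.mpr (by omega)
        have hyv : y < v := by
          rcases eq_or_lt_of_le (Nat.lt_succ_iff.mp hy.2.1) with he | hl'
          · rw [Fin.ext he] at hy; omega
          · exact hl'
        have huy : u < y := by
          rcases eq_or_lt_of_le hy.1 with he | hl'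
          · have he : u = y := Fin.ext he
            subst he
            exact absurd (h.right_unique huv hR) hvp.ne
          · exact hl'
        exact h.not_interlacing huv hR (Fin.ext (by omega)) huy hyv hvp
      · intro y hy y' hy' he
        simp only [Finset.coe_filter, Finset.mem_univ, true_and, Set.mem_ofPred_eq] at hy hy'
        exact h.left_unique (hp y hy.2.2) (he ▸ hp y' hy'.2.2)
    push_cast
    omega
  simp only [← ha]
  omega

lemma IsMatching.iff_matches {w : Fin m → Fin n} {R : Fin m → Fin m → Prop}
    (h : IsMatching w R) {u v : Fin m} : R u v ↔ Matches w u v := by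
  refine ⟨h.matches, fun hm => ?_⟩
  obtain ⟨u', hu'⟩ := h.exists_left v (by have := hm.2.1; omega)
  rwa [hm.left_unique (h.matches hu')]

lemma isMatching_matches {w : Fin m → Fin n} (hw : IsLatticeWord w) {k : ℕ}
    (hk : ∀ a : Fin n, (Finset.univ.filter fun j => w j = a).card = k) :
    IsMatching w (Matches w) where
  lt h := h.1
  letter h := h.2.1
  left_unique := Matches.left_unique
  right_unique := Matches.right_unique
  exists_right u hu := by
    refine exists_matches_right hw u ?_
    have := prefixCount_length w ⟨w u + 1, hu⟩
    rw [prefixCount_length w (w u), hk, ← hk ⟨w u + 1, hu⟩, ← this]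
  exists_left v hv := exists_matches_left hw v hv
  not_interlacing := Matches.not_interlacing

end Matching

/-! ### From wave graphs to noncrossing matchings -/

section WaveGraphs

variable {n m : ℕ}

lemma BookDrawing.im_arc_nonneg {G : SimpleGraph (Fin m)} {K : ℕ} (D : BookDrawing G K)
    {e : G.edgeSet} {u v : Fin m} (he : (e : Sym2 (Fin m)) = s(u, v)) (t : unitInterval) :
    0 ≤ (D.arc e t).im ∧ (t ∉ Set.Ioo (0 : unitInterval) 1 →
      D.arc e t = vertexPoint u ∨ D.arc e t = vertexPoint v) := by
  by_cases ht : t ∈ Set.Ioo (0 : unitInterval) 1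
  · exact ⟨(D.arc_interior e t ht).le, fun h => absurd ht h⟩
  · have h01 : t = 0 ∨ t = 1 := by
      by_contra! hcon
      exact ht ⟨lt_of_le_of_ne unitInterval.nonneg' hcon.1.symm,
        lt_of_le_of_ne unitInterval.le_one' hcon.2⟩
    have hends := D.arc_ends e
    rw [he, Sym2.map_mk, Sym2.eq_iff] at hends
    have hor : D.arc e t = vertexPoint u ∨ D.arc e t = vertexPoint v := by
      rcases h01 with rfl | rfl <;> tauto
    refine ⟨?_, fun _ => hor⟩
    rcases hor with h | h <;> simp [h, vertexPoint]

/-- The arc of an edge, traversed from either one of its endpoints to the other. -/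
lemma BookDrawing.exists_orientation {G : SimpleGraph (Fin m)} {K : ℕ} (D : BookDrawing G K)
    {e : G.edgeSet} {u v : Fin m} (he : (e : Sym2 (Fin m)) = s(u, v)) :
    ∃ σ : C(unitInterval, unitInterval),
      D.arc e (σ 0) = vertexPoint u ∧ D.arc e (σ 1) = vertexPoint v := by
  have hends := D.arc_ends e
  rw [he, Sym2.map_mk, Sym2.eq_iff] at hends
  rcases hends with h | h
  · exact ⟨ContinuousMap.id _, h⟩
  · exact ⟨⟨unitInterval.symm, unitInterval.continuous_symm⟩, by simpa using ⟨h.2, h.1⟩⟩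

lemma vertexPoint_injective : Function.Injective (vertexPoint : Fin m → ℂ) := by
  intro i j h
  simpa [vertexPoint, Fin.ext_iff] using h

/-- Two edges with interlacing endpoints cannot be drawn on the same page. -/
lemma BookDrawing.not_interlacing {G : SimpleGraph (Fin m)} {K : ℕ} (D : BookDrawing G K)
    {e f : G.edgeSet} {u v u' v' : Fin m} (he : (e : Sym2 (Fin m)) = s(u, v))
    (hf : (f : Sym2 (Fin m)) = s(u', v')) (hpage : D.page e = D.page f) (h1 : u < u')
    (h2 : u' < v) (h3 : v < v') : False := by
  obtain ⟨σ, hσ0, hσ1⟩ := D.exists_orientation he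
  obtain ⟨τ, hτ0, hτ1⟩ := D.exists_orientation hf
  have hef : e ≠ f := by
    rintro rfl
    rw [he, Sym2.eq_iff] at hf
    omega
  obtain ⟨s, t, hst⟩ := exists_eq_of_interlacing (γ := (D.arc e).comp σ) (δ := (D.arc f).comp τ)
    (a := (u : ℕ) + 1) (b := (u' : ℕ) + 1) (c := (v : ℕ) + 1) (d := (v' : ℕ) + 1)
    (by simpa using h1) (by simpa using h2) (by simpa using h3)
    (by simpa [vertexPoint] using hσ0) (by simpa [vertexPoint] using hσ1)
    (by simpa [vertexPoint] using hτ0) (by simpa [vertexPoint] using hτ1)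
    (fun t => (D.im_arc_nonneg he _).1) (fun t => (D.im_arc_nonneg hf _).1)
  simp only [ContinuousMap.comp_apply] at hst
  -- Inner points of an arc have positive imaginary part and its ends are real, so a common point is
  -- inner to both arcs or an end of both; the four ends are distinct.
  by_cases hs : σ s ∈ Set.Ioo (0 : unitInterval) 1
  · by_cases ht : τ t ∈ Set.Ioo (0 : unitInterval) 1
    · exact D.no_intersection e f hef hpage _ hs _ ht hst
    · have hpos := D.arc_interior e _ hs
      rw [hst] at hpos
      rcases (D.im_arc_nonneg hf _).2 ht with h | h <;> simp [h, vertexPoint] at hpos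
  · by_cases ht : τ t ∈ Set.Ioo (0 : unitInterval) 1
    · have hpos := D.arc_interior f _ ht
      rw [← hst] at hpos
      rcases (D.im_arc_nonneg he _).2 hs with h | h <;> simp [h, vertexPoint] at hpos
    · rcases (D.im_arc_nonneg he _).2 hs with h | h <;>
        rcases (D.im_arc_nonneg hf _).2 ht with h' | h' <;>
        · rw [h, h'] at hst
          have := vertexPoint_injective hst
          omega

/-- A strictly increasing enumeration is determined by its range, here the component. -/
lemma IsWave.eq {G : SimpleGraph (Fin m)} {c : G.ConnectedComponent}
    {p q : SimpleGraph.pathGraph n ≃g c.toSimpleGraph} (hp : IsWave c p) (hq : IsWave c q) :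
    p = q := by
  have hr : Set.range (fun a => (p a : Fin m)) = Set.range (fun a => (q a : Fin m)) := by
    have : ∀ p : SimpleGraph.pathGraph n ≃g c.toSimpleGraph,
        Set.range (fun a => (p a : Fin m)) = Set.range (Subtype.val : c → Fin m) :=
      fun p => p.surjective.range_comp _
    rw [this, this]
  have := (StrictMono.range_inj hp hq).mp hr
  ext a
  exact congrArg Fin.val (congrFun this a)

/-- The position of each vertex of an `n`-wave graph in the path which is its component. -/
def wavePosition {G : SimpleGraph (Fin m)}
    (wave : ∀ c : G.ConnectedComponent, SimpleGraph.pathGraph n ≃g c.toSimpleGraph) (v : Fin m) :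
    Fin n :=
  (wave (G.connectedComponentMk v)).symm ⟨v, rfl⟩

variable {G : SimpleGraph (Fin m)}
  (wave : ∀ c : G.ConnectedComponent, SimpleGraph.pathGraph n ≃g c.toSimpleGraph)

lemma wavePosition_apply {c : G.ConnectedComponent} (x : c) :
    wavePosition wave x = (wave c).symm x := by
  obtain ⟨v, hv⟩ := x
  obtain rfl : G.connectedComponentMk v = c := hv
  rfl

lemma wavePosition_wave (c : G.ConnectedComponent) (a : Fin n) :
    wavePosition wave (wave c a) = a := by
  rw [wavePosition_apply, RelIso.symm_apply_apply]

lemma wave_wavePosition (v : Fin m) :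
    (wave (G.connectedComponentMk v) (wavePosition wave v) : Fin m) = v := by
  rw [wavePosition, RelIso.apply_symm_apply]

lemma connectedComponentMk_wave (c : G.ConnectedComponent) (a : Fin n) :
    G.connectedComponentMk (wave c a : Fin m) = c := (wave c a).2

lemma wave_adj (c : G.ConnectedComponent) (a b : Fin n) :
    G.Adj (wave c a) (wave c b) ↔ (a : ℕ) + 1 = b ∨ (b : ℕ) + 1 = a := by
  rw [← SimpleGraph.pathGraph_adj, ← (wave c).map_adj_iff]
  rfl

/-- The vertices correspond to pairs of a component and a position. -/
def waveEquiv : G.ConnectedComponent × Fin n ≃ Fin m where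
  toFun x := wave x.1 x.2
  invFun v := (G.connectedComponentMk v, wavePosition wave v)
  left_inv _ := Prod.ext (connectedComponentMk_wave wave _ _) (wavePosition_wave wave _ _)
  right_inv v := wave_wavePosition wave v

lemma card_wavePosition_eq (a : Fin n) :
    (Finset.univ.filter fun j => wavePosition wave j = a).card = Nat.card G.ConnectedComponent := by
  rw [← Fintype.card_subtype, ← Nat.card_eq_fintype_card]
  refine Nat.card_congr (Equiv.ofBijective
    (fun c => (⟨wave c a, wavePosition_wave wave c a⟩ : {v // wavePosition wave v = a}))
    ⟨fun c c' h => ?_, fun v => ⟨G.connectedComponentMk v.1, Subtype.ext ?_⟩⟩).symm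
  · rw [← connectedComponentMk_wave wave c a, ← connectedComponentMk_wave wave c' a]
    exact congrArg _ (Subtype.ext_iff.mp h)
  · have := wave_wavePosition wave v.1
    rwa [v.2] at this

lemma card_connectedComponent_mul {G : SimpleGraph (Fin m)}
    (wave : ∀ c : G.ConnectedComponent, SimpleGraph.pathGraph n ≃g c.toSimpleGraph) :
    Nat.card G.ConnectedComponent * n = m := by
  have := Nat.card_congr (waveEquiv wave)
  rwa [Nat.card_prod, Nat.card_fin, Nat.card_fin] at this

lemma wavePosition_of_adj {u v : Fin m} (h : G.Adj u v) :
    (wavePosition wave u : ℕ) + 1 = wavePosition wave v ∨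
      (wavePosition wave v : ℕ) + 1 = wavePosition wave u := by
  have hc : G.connectedComponentMk u = G.connectedComponentMk v :=
    SimpleGraph.ConnectedComponent.sound h.reachable
  rw [← wave_adj wave (G.connectedComponentMk u), wave_wavePosition, hc, wave_wavePosition]
  exact h

lemma adj_iff_wavePosition {u v : Fin m} : G.Adj u v ↔
    (G.Adj u v ∧ (wavePosition wave v : ℕ) = wavePosition wave u + 1) ∨
      (G.Adj v u ∧ (wavePosition wave u : ℕ) = wavePosition wave v + 1) := by
  constructor
  · intro h
    rcases wavePosition_of_adj wave h with h' | h'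
    · exact Or.inl ⟨h, h'.symm⟩
    · exact Or.inr ⟨h.symm, h'.symm⟩
  · rintro (h | h)
    · exact h.1
    · exact h.1.symm

/-- Edges whose left ends have equal positions share a page, which excludes interlacing. The other
properties come from single steps along the paths. -/
lemma isMatching_wavePosition (hwave : ∀ c, IsWave c (wave c)) (D : BookDrawing G (n - 1))
    (hD : ∀ (c : G.ConnectedComponent) (a b : Fin n) (e : G.edgeSet), (a : ℕ) + 1 = b →
      (e : Sym2 (Fin m)) = s((wave c a : Fin m), (wave c b : Fin m)) → (D.page e : ℕ) = a) :
    IsMatching (wavePosition wave) (fun u v => G.Adj u v ∧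
      (wavePosition wave v : ℕ) = wavePosition wave u + 1) := by
  have hcomp : ∀ {u v}, G.Adj u v → G.connectedComponentMk u = G.connectedComponentMk v :=
    fun h => SimpleGraph.ConnectedComponent.sound h.reachable
  have heq : ∀ {u v}, G.connectedComponentMk u = G.connectedComponentMk v →
      (wavePosition wave u : ℕ) = wavePosition wave v → u = v := by
    intro u v h h'
    rw [← wave_wavePosition wave u, ← wave_wavePosition wave v, h, Fin.ext h']
  have hpage : ∀ {u v} (h : G.Adj u v), (wavePosition wave v : ℕ) = wavePosition wave u + 1 →
      (D.page ⟨s(u, v), h⟩ : ℕ) = wavePosition wave u := by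
    intro u v h h'
    refine hD (G.connectedComponentMk u) (wavePosition wave u) (wavePosition wave v) _ h'.symm ?_
    rw [wave_wavePosition, hcomp h, wave_wavePosition]
  constructor
  · rintro u v ⟨h, h'⟩
    rw [← wave_wavePosition wave u, ← wave_wavePosition wave v, hcomp h]
    exact hwave _ (Fin.lt_def.mpr (by omega))
  · exact fun h => h.2
  · rintro u u' v ⟨h, h'⟩ ⟨h1, h1'⟩
    exact heq ((hcomp h).trans (hcomp h1).symm) (by omega)
  · rintro u v v' ⟨h, h'⟩ ⟨h1, h1'⟩
    exact heq ((hcomp h).symm.trans (hcomp h1)) (by omega)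
  · intro u hu
    refine ⟨wave (G.connectedComponentMk u) ⟨wavePosition wave u + 1, hu⟩, ?_, ?_⟩
    · have := (wave_adj wave (G.connectedComponentMk u) (wavePosition wave u)
        ⟨wavePosition wave u + 1, hu⟩).mpr (Or.inl rfl)
      rwa [wave_wavePosition] at this
    · rw [wavePosition_wave]
  · intro v hv
    have hlt : (wavePosition wave v : ℕ) - 1 < n := by omega
    refine ⟨wave (G.connectedComponentMk v) ⟨wavePosition wave v - 1, hlt⟩, ?_, ?_⟩
    · have := (wave_adj wave (G.connectedComponentMk v) ⟨wavePosition wave v - 1, hlt⟩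
        (wavePosition wave v)).mpr (Or.inl (by simp only; omega))
      rwa [wave_wavePosition] at this
    · rw [wavePosition_wave]
      simp only
      omega
  · rintro u v u' v' ⟨h, h'⟩ ⟨h1, h1'⟩ hw
    refine D.not_interlacing (e := ⟨s(u, v), h⟩) (f := ⟨s(u', v'), h1⟩) rfl rfl (Fin.ext ?_)
    rw [hpage h h', hpage h1 h1', hw]

end WaveGraphs

/-! ### From lattice words to wave graphs -/

section MatchingGraph

variable {n m : ℕ}

/-- The graph whose edges join the matching letters `a` and `a + 1` of the word `w`. -/
def matchingGraph (w : Fin m → Fin n) : SimpleGraph (Fin m) where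
  Adj u v := Matches w u v ∨ Matches w v u
  symm := ⟨fun _ _ h => h.symm⟩
  loopless := ⟨fun u h => (lt_irrefl u (h.elim (fun h => h.1) fun h => h.1))⟩

variable {w : Fin m → Fin n}

/-- Partners are iterated to the right of `v` for the letters above `w v` and to the left for those
below. -/
lemma IsMatching.exists_chain {R : Fin m → Fin m → Prop} (h : IsMatching w R) (v : Fin m) :
    ∃ f : Fin n → Fin m, f (w v) = v ∧ (∀ a, w (f a) = a) ∧
      ∀ a b : Fin n, (a : ℕ) + 1 = b → R (f a) (f b) := by
  have hnext : ∀ u, ∃ v, (w u : ℕ) + 1 < n → R u v := fun u => by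
    by_cases hu : (w u : ℕ) + 1 < n
    · obtain ⟨v, hv⟩ := h.exists_right u hu
      exact ⟨v, fun _ => hv⟩
    · exact ⟨u, fun h => absurd h hu⟩
  have hprev : ∀ v, ∃ u, 0 < (w v : ℕ) → R u v := fun v => by
    by_cases hv : 0 < (w v : ℕ)
    · obtain ⟨u, hu⟩ := h.exists_left v hv
      exact ⟨u, fun _ => hu⟩
    · exact ⟨v, fun h => absurd h hv⟩
  choose next hnext using hnext
  choose prev hprev using hprev
  have hn : ∀ k, (w v : ℕ) + k < n → (w (next^[k] v) : ℕ) = w v + k := by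
    intro k
    induction k with
    | zero => intro _; rfl
    | succ k ih =>
      intro hk
      have h1 := ih (by omega)
      have h2 := h.letter (hnext (next^[k] v) (by omega))
      rw [Function.iterate_succ_apply']
      omega
  have hp : ∀ k, k ≤ (w v : ℕ) → (w (prev^[k] v) : ℕ) = w v - k := by
    intro k
    induction k with
    | zero => intro _; simp
    | succ k ih =>
      intro hk
      have h1 := ih (by omega)
      have h2 := h.letter (hprev (prev^[k] v) (by omega))
      rw [Function.iterate_succ_apply']
      omega
  refine ⟨fun a => if a ≤ w v then prev^[(w v : ℕ) - a] v else next^[(a : ℕ) - w v] v, ?_, ?_, ?_⟩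
  · simp
  · intro a
    apply Fin.ext
    simp only [Fin.le_def]
    split_ifs with ha
    · rw [hp _ (by omega)]; omega
    · have := a.2
      rw [hn _ (by omega)]; omega
  · intro a b hab
    have hb := b.2
    simp only [Fin.le_def]
    rcases lt_trichotomy (a : ℕ) (w v) with hlt | heq | hgt
    · rw [if_pos (by omega), if_pos (by omega)]
      obtain ⟨k, hk⟩ : ∃ k, k = (w v : ℕ) - b := ⟨_, rfl⟩
      rw [← hk, show (w v : ℕ) - a = k + 1 by omega, Function.iterate_succ_apply']
      exact hprev _ (by rw [hp _ (by omega)]; omega)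
    · rw [if_pos (by omega), if_neg (by omega), show (w v : ℕ) - a = 0 by omega,
        show (b : ℕ) - w v = 1 by omega]
      exact hnext v (by omega)
    · rw [if_neg (by omega), if_neg (by omega)]
      obtain ⟨k, hk⟩ : ∃ k, k = (a : ℕ) - w v := ⟨_, rfl⟩
      rw [← hk, show (b : ℕ) - w v = k + 1 by omega, Function.iterate_succ_apply']
      exact hnext _ (by rw [hn _ (by omega)]; omega)

lemma exists_iso_of_isMatching (h : IsMatching w (Matches w))
    (c : (matchingGraph w).ConnectedComponent) :
    ∃ p : SimpleGraph.pathGraph n ≃g c.toSimpleGraph, IsWave c p ∧ ∀ a, w (p a) = a := by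
  induction c using SimpleGraph.ConnectedComponent.ind with | h v =>
  obtain ⟨f, hfv, hwf, hf⟩ := h.exists_chain v
  have hadj : ∀ a b, (matchingGraph w).Adj (f a) (f b) ↔ (a : ℕ) + 1 = b ∨ (b : ℕ) + 1 = a := by
    intro a b
    constructor
    · rintro (hab | hab)
      · have := h.letter hab
        rw [hwf, hwf] at this
        exact Or.inl this.symm
      · have := h.letter hab
        rw [hwf, hwf] at this
        exact Or.inr this.symm
    · rintro (hab | hab)
      · exact Or.inl (hf _ _ hab)
      · exact Or.inr (hf _ _ hab)
  have hcomp0 : ∀ k (hk : k < n), (matchingGraph w).connectedComponentMk (f ⟨k, hk⟩) =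
      (matchingGraph w).connectedComponentMk (f ⟨0, by omega⟩) := by
    intro k
    induction k with
    | zero => intro _; rfl
    | succ k ih =>
      intro hk
      rw [← ih (by omega)]
      exact SimpleGraph.ConnectedComponent.sound
        ((hadj ⟨k + 1, hk⟩ ⟨k, by omega⟩).mpr (Or.inr rfl)).reachable
  have hcomp : ∀ a, f a ∈ (matchingGraph w).connectedComponentMk v := by
    intro a
    have := (hcomp0 a a.2).trans (hcomp0 (w v) (w v).2).symm
    rw [Fin.eta, Fin.eta, hfv] at this
    exact this
  -- Since partners are unique on both sides, a walk starting at `v` never leaves the chain.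
  have hsurj : ∀ x, (matchingGraph w).Reachable v x → ∃ a, f a = x := by
    intro x hx
    rw [SimpleGraph.reachable_iff_reflTransGen] at hx
    induction hx with
    | refl => exact ⟨_, hfv⟩
    | @tail x y _ hxy ih =>
      obtain ⟨a, rfl⟩ := ih
      rcases hxy with hxy | hxy
      · have hl := h.letter hxy
        rw [hwf] at hl
        exact ⟨w y, h.right_unique (hf a (w y) hl.symm) hxy⟩
      · have hl := h.letter hxy
        rw [hwf] at hl
        exact ⟨w y, h.left_unique (hf (w y) a hl.symm) hxy⟩
  let p : SimpleGraph.pathGraph n ≃g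
      ((matchingGraph w).connectedComponentMk v).toSimpleGraph :=
    { toEquiv := Equiv.ofBijective (fun a => ⟨f a, hcomp a⟩) (by
        constructor
        · intro a b hab
          rw [← hwf a, ← hwf b]
          exact congrArg w (Subtype.ext_iff.mp hab)
        · rintro ⟨x, hx⟩
          obtain ⟨a, rfl⟩ := hsurj x (SimpleGraph.ConnectedComponent.exact hx).symm
          exact ⟨a, rfl⟩)
      map_rel_iff' := by
        intro a b
        rw [SimpleGraph.pathGraph_adj, ← hadj]
        rfl }
  refine ⟨p, ?_, hwf⟩
  have hlt : ∀ k (hk : k < n) (j) (hj : j < k), f ⟨j, by omega⟩ < f ⟨k, hk⟩ := by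
    intro k
    induction k with
    | zero => intro _ j hj; omega
    | succ k ih =>
      intro hk j hj
      have h1 := h.lt (hf ⟨k, by omega⟩ ⟨k + 1, hk⟩ rfl)
      rcases eq_or_lt_of_le (Nat.lt_succ_iff.mp hj) with rfl | hjk
      · exact h1
      · exact (ih (by omega) j hjk).trans h1
  exact fun a b hab => hlt b b.2 a hab

/-- Each edge becomes the parabola over its segment, on the page of its smaller letter. Distinct
edges on one page share no endpoint and do not interlace, so their segments are nested or disjoint.
-/
lemma exists_bookDrawing_of_isMatching (h : IsMatching w (Matches w)) :
    ∃ D : BookDrawing (matchingGraph w) (n - 1), ∀ (u v : Fin m)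
      (e : (matchingGraph w).edgeSet), (w u : ℕ) + 1 = w v → (e : Sym2 (Fin m)) = s(u, v) →
        (D.page e : ℕ) = w u := by
  have hex : ∀ e : (matchingGraph w).edgeSet, ∃ x : Fin m × Fin m,
      (e : Sym2 (Fin m)) = s(x.1, x.2) ∧ Matches w x.1 x.2 := by
    rintro ⟨e, he⟩
    induction e using Sym2.ind with | _ x y =>
    rcases he with he | he
    · exact ⟨(x, y), rfl, he⟩
    · exact ⟨(y, x), Sym2.eq_swap, he⟩
  choose x hx hm using hex
  have hpage : ∀ e, (w (x e).1 : ℕ) < n - 1 := fun e => by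
    have := h.letter (hm e)
    have := (w (x e).2).2
    omega
  have hlt : ∀ e, (((x e).1 : ℕ) : ℝ) + 1 < (((x e).2 : ℕ) : ℝ) + 1 := fun e => by
    have := Fin.lt_def.mp (h.lt (hm e))
    gcongr
  refine ⟨⟨fun e => ⟨w (x e).1, hpage e⟩,
    fun e => parabolaArc (((x e).1 : ℕ) + 1) (((x e).2 : ℕ) + 1), fun e =>
      parabolaArc_injective (hlt e).ne, ?_, ?_, ?_⟩, ?_⟩
  · intro e
    rw [parabolaArc_zero, parabolaArc_one, hx, Sym2.map_mk]
    simp [vertexPoint]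
  · intro e t ht
    exact parabolaArc_im_pos (hlt e) ht
  · intro e f hef hp s hs t ht
    refine parabolaArc_ne (hlt e) (hlt f) ?_ hs ht
    have hw : w (x e).1 = w (x f).1 := Fin.ext (Fin.mk.inj_iff.mp hp)
    have aux : ∀ e f, e ≠ f → w (x e).1 = w (x f).1 → (x e).1 < (x f).1 →
        (x f).2 < (x e).2 ∨ (x e).2 < (x f).1 := by
      intro e f hef hw hlt
      have hne : (x e).2 ≠ (x f).2 := by
        intro heq
        exact hlt.ne (h.left_unique (hm e) (heq ▸ hm f))
      have hne2 : (x f).1 ≠ (x e).2 := by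
        intro heq
        have := h.letter (hm e)
        rw [← heq, hw] at this
        omega
      rcases lt_or_gt_of_ne hne with h1 | h1
      · rcases lt_or_gt_of_ne hne2 with h2 | h2
        · exact (h.not_interlacing (hm e) (hm f) hw hlt h2 h1).elim
        · exact Or.inr h2
      · exact Or.inl h1
    have hne1 : (x e).1 ≠ (x f).1 := by
      intro heq
      apply hef
      apply Subtype.ext
      rw [hx e, hx f, heq, h.right_unique (hm e) (heq ▸ hm f)]
    have hcast : ∀ i j : Fin m, i < j → ((i : ℕ) : ℝ) + 1 < ((j : ℕ) : ℝ) + 1 := by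
      intro i j hij
      have := Fin.lt_def.mp hij
      gcongr
    rcases lt_or_gt_of_ne hne1 with h1 | h1
    · rcases aux e f hef hw h1 with h2 | h2
      · exact Or.inl ⟨hcast _ _ h1, hcast _ _ h2⟩
      · exact Or.inr (Or.inr (Or.inl (hcast _ _ h2)))
    · rcases aux f e hef.symm hw.symm h1 with h2 | h2
      · exact Or.inr (Or.inl ⟨hcast _ _ h1, hcast _ _ h2⟩)
      · exact Or.inr (Or.inr (Or.inr (hcast _ _ h2)))
  · intro u v e huv he
    have := h.letter (hm e)
    rw [hx e, Sym2.eq_iff] at he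
    rcases he with ⟨h1, h2⟩ | ⟨h1, h2⟩
    · simp only [h1]
    · rw [h1, h2] at this
      omega

lemma isWaveGraph_of_isMatching (h : IsMatching w (Matches w)) :
    IsWaveGraph n (matchingGraph w) := by
  choose wave hwave hw using exists_iso_of_isMatching h
  obtain ⟨D, hD⟩ := exists_bookDrawing_of_isMatching h
  refine ⟨wave, hwave, D, fun c a b e hab he => ?_⟩
  have := hD _ _ e (by rw [hw, hw]; exact hab) he
  rwa [hw] at this

end MatchingGraph

lemma WaveGraph.exists_card {n m : ℕ} (G : WaveGraph n m) : ∃ k, m = k * n := by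
  obtain ⟨G, wave, -⟩ := G
  exact ⟨_, (card_connectedComponent_mul wave).symm⟩

/-- The bijection which sends an `n`-wave graph to the word formed by the positions of the vertices
in their components. -/
lemma exists_waveGraph_equiv {n m k : ℕ} (hn : 1 ≤ n) (hm : m = k * n) :
    ∃ Φ : WaveGraph n m ≃ BalancedLatticeWord n k m,
      ∀ (G : WaveGraph n m) (c : G.1.ConnectedComponent)
        (p : SimpleGraph.pathGraph n ≃g c.toSimpleGraph), IsWave c p →
          ∀ a : Fin n, (Φ G).1 (p a) = a := by
  have hex : ∀ G : WaveGraph n m, ∃ W : BalancedLatticeWord n k m,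
      (∀ u v, G.1.Adj u v ↔ Matches W.1 u v ∨ Matches W.1 v u) ∧
      ∀ (c : G.1.ConnectedComponent) (p : SimpleGraph.pathGraph n ≃g c.toSimpleGraph),
        IsWave c p → ∀ a : Fin n, W.1 (p a) = a := by
    rintro ⟨G, wave, hwave, D, hD⟩
    have hM := isMatching_wavePosition wave hwave D hD
    have hcard : Nat.card G.ConnectedComponent = k :=
      Nat.eq_of_mul_eq_mul_right hn ((card_connectedComponent_mul wave).trans hm)
    refine ⟨⟨wavePosition wave, hM.isLatticeWord,
      fun a => (card_wavePosition_eq wave a).trans hcard⟩, ?_, ?_⟩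
    · intro u v
      rw [← hM.iff_matches, ← hM.iff_matches]
      exact adj_iff_wavePosition wave
    · intro c p hp a
      rw [hp.eq (hwave c)]
      exact wavePosition_wave wave c a
  choose Φ hadj hΦ using hex
  refine ⟨Equiv.ofBijective Φ ⟨?_, ?_⟩, hΦ⟩
  -- Injectivity: adjacency is the matching relation of the word.
  · intro G G' h
    apply Subtype.ext
    ext u v
    rw [hadj, hadj, h]
  -- Surjectivity: in the matching graph, the position of a vertex in its path is its letter.
  · intro W
    have hM := isMatching_matches W.2.1 W.2.2
    refine ⟨⟨matchingGraph W.1, isWaveGraph_of_isMatching hM⟩, Subtype.ext (funext fun v => ?_)⟩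
    obtain ⟨p, hp, hw⟩ := exists_iso_of_isMatching hM ((matchingGraph W.1).connectedComponentMk v)
    obtain ⟨a, ha⟩ := p.surjective ⟨v, rfl⟩
    have h1 := hΦ ⟨matchingGraph W.1, isWaveGraph_of_isMatching hM⟩ _ p hp a
    have h2 := hw a
    rw [ha] at h1 h2
    exact h1.trans h2.symm

/-! ### Rectangular standard tableaux and lattice words -/

section Tableaux

variable {n m k : ℕ}

lemma mem_rectDiagram {r c : ℕ} : (r, c) ∈ rectDiagram n k ↔ r < k ∧ c < n := by
  simp [← YoungDiagram.mem_cells, rectDiagram]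

lemma mem_coe_cells_rectDiagram {x : ℕ × ℕ} :
    x ∈ ((rectDiagram n k).cells : Set (ℕ × ℕ)) ↔ x.1 < k ∧ x.2 < n := by
  simp [rectDiagram]

lemma card_rectDiagram : (rectDiagram n k).card = k * n := by
  simp [YoungDiagram.card, rectDiagram]

lemma StandardTableau.mem_Icc (T : StandardTableau (rectDiagram n k)) {r c : ℕ} (hr : r < k)
    (hc : c < n) : 1 ≤ T.1 r c ∧ T.1 r c ≤ k * n := by
  have := T.2.mapsTo (x := (r, c)) (mem_coe_cells_rectDiagram.mpr ⟨hr, hc⟩)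
  exact ⟨this.1, this.2.trans card_rectDiagram.le⟩

lemma StandardTableau.exists_cell (T : StandardTableau (rectDiagram n k)) {x : ℕ}
    (hx : x < k * n) : ∃ r c, r < k ∧ c < n ∧ T.1 r c = x + 1 := by
  have : x + 1 ∈ Set.Icc 1 (rectDiagram n k).card := by
    rw [card_rectDiagram, Set.mem_Icc]; omega
  obtain ⟨⟨r, c⟩, hrc, h⟩ := T.2.surjOn this
  have := mem_coe_cells_rectDiagram.mp hrc
  exact ⟨r, c, this.1, this.2, h⟩

lemma StandardTableau.cell_unique (T : StandardTableau (rectDiagram n k)) {r c r' c' : ℕ}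
    (hr : r < k) (hc : c < n) (hr' : r' < k) (hc' : c' < n) (h : T.1 r c = T.1 r' c') :
    r = r' ∧ c = c' := by
  exact Prod.mk_inj.mp (T.2.injOn (x₁ := (r, c)) (x₂ := (r', c'))
    (mem_coe_cells_rectDiagram.mpr ⟨hr, hc⟩) (mem_coe_cells_rectDiagram.mpr ⟨hr', hc'⟩) h)

/-- `w` is the word of the columns of the entries of the tableau `T`. -/
def IsColumnWord (T : StandardTableau (rectDiagram n k)) (w : Fin m → Fin n) : Prop :=
  ∀ (i : Fin m) (r c : ℕ), r < k → c < n → T.1 r c = i + 1 → (w i : ℕ) = c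

lemma exists_isColumnWord (T : StandardTableau (rectDiagram n k)) (hm : m = k * n) :
    ∃ w : Fin m → Fin n, IsColumnWord T w := by
  subst hm
  have : ∀ i : Fin (k * n), ∃ c : Fin n, ∃ r < k, T.1 r c = i + 1 := fun i => by
    obtain ⟨r, c, hr, hc, h⟩ := T.exists_cell i.2
    exact ⟨⟨c, hc⟩, r, hr, h⟩
  choose w r hr hw using this
  refine ⟨w, fun i r' c' hr' hc' h => ?_⟩
  exact (T.cell_unique (hr i) (w i).2 hr' hc' ((hw i).trans h.symm)).2

lemma IsColumnWord.prefixCount_eq {T : StandardTableau (rectDiagram n k)} {w : Fin m → Fin n}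
    (h : IsColumnWord T w) (hm : m = k * n) {c : ℕ} (hc : c < n) (x : ℕ) :
    prefixCount w c x = ((Finset.range k).filter fun r => T.1 r c ≤ x).card := by
  subst hm
  symm
  have hpos : ∀ {r}, r < k → T.1 r c - 1 < k * n := fun hr => by
    have := T.mem_Icc hr hc
    omega
  refine Finset.card_bij (fun r hr =>
    ⟨T.1 r c - 1, hpos (Finset.mem_range.mp (Finset.mem_filter.mp hr).1)⟩) ?_ ?_ ?_
  · intro r hr
    obtain ⟨h1, h2⟩ := Finset.mem_filter.mp hr
    have h1 := Finset.mem_range.mp h1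
    have h3 := T.mem_Icc h1 hc
    simp only [Finset.mem_filter, Finset.mem_univ, true_and]
    refine ⟨by omega, h _ r c h1 hc ?_⟩
    simp only
    omega
  · intro r hr r' hr' he
    have h1 := Finset.mem_range.mp (Finset.mem_filter.mp hr).1
    have h1' := Finset.mem_range.mp (Finset.mem_filter.mp hr').1
    have h2 := T.mem_Icc h1 hc
    have h2' := T.mem_Icc h1' hc
    have he := Fin.mk.inj_iff.mp he
    exact (T.cell_unique h1 hc h1' hc (by omega)).1
  · intro i hi
    simp only [Finset.mem_filter, Finset.mem_univ, true_and] at hi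
    obtain ⟨r, c', hr, hc', hT⟩ := T.exists_cell i.2
    have := h i r c' hr hc' hT
    obtain rfl : c' = c := by omega
    refine ⟨r, Finset.mem_filter.mpr ⟨Finset.mem_range.mpr hr, by omega⟩, Fin.ext ?_⟩
    simp only
    omega

/-- As entries increase down a column, those at most `x` fill its top cells. Thus the word
determines every entry of the tableau. -/
lemma IsColumnWord.le_iff_lt_prefixCount {T : StandardTableau (rectDiagram n k)}
    {w : Fin m → Fin n} (h : IsColumnWord T w) (hm : m = k * n) {r c : ℕ} (hr : r < k)
    (hc : c < n) (x : ℕ) : T.1 r c ≤ x ↔ r < prefixCount w c x := by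
  have hmono : ∀ {r r'}, r ≤ r' → r' < k → T.1 r c ≤ T.1 r' c := fun hle hr' =>
    T.1.col_weak hle (mem_rectDiagram.mpr ⟨hr', hc⟩)
  rw [h.prefixCount_eq hm hc]
  constructor
  · intro hx
    have : Finset.range (r + 1) ⊆ (Finset.range k).filter fun r => T.1 r c ≤ x := by
      intro r' hr'
      have hr' := Finset.mem_range.mp hr'
      exact Finset.mem_filter.mpr ⟨Finset.mem_range.mpr (by omega),
        (hmono (by omega) hr).trans hx⟩
    simpa using Finset.card_le_card this
  · intro hcard
    by_contra hx
    have : ((Finset.range k).filter fun r => T.1 r c ≤ x) ⊆ Finset.range r := by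
      intro r' hr'
      obtain ⟨h1, h2⟩ := Finset.mem_filter.mp hr'
      rw [Finset.mem_range] at h1 ⊢
      by_contra hle
      exact hx ((hmono (not_lt.mp hle) h1).trans h2)
    have := Finset.card_le_card this
    rw [Finset.card_range] at this
    omega

lemma IsColumnWord.isLatticeWord {T : StandardTableau (rectDiagram n k)}
    {w : Fin m → Fin n} (h : IsColumnWord T w) (hm : m = k * n) : IsLatticeWord w := by
  rw [isLatticeWord_iff_prefixCount]
  intro a x
  by_cases ha : n ≤ a + 1
  · rw [prefixCount_of_le w ha]; omega
  · rw [h.prefixCount_eq hm (by omega), h.prefixCount_eq hm (by omega)]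
    refine Finset.card_le_card fun r hr => ?_
    obtain ⟨h1, h2⟩ := Finset.mem_filter.mp hr
    refine Finset.mem_filter.mpr ⟨h1, le_trans ?_ h2⟩
    exact T.1.row_weak (Nat.lt_succ_self a)
      (mem_rectDiagram.mpr ⟨Finset.mem_range.mp h1, by omega⟩)

lemma IsColumnWord.card_eq {T : StandardTableau (rectDiagram n k)}
    {w : Fin m → Fin n} (h : IsColumnWord T w) (hm : m = k * n) (a : Fin n) :
    (Finset.univ.filter fun j => w j = a).card = k := by
  rw [← prefixCount_length, h.prefixCount_eq hm a.2, Finset.filter_true_of_mem,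
    Finset.card_range]
  intro r hr
  rw [hm]
  exact (T.mem_Icc (Finset.mem_range.mp hr) a.2).2

lemma prefixCount_antitone {w : Fin m → Fin n} (hw : IsLatticeWord w) (x : ℕ) :
    Antitone fun a => prefixCount w a x :=
  antitone_nat_of_succ_le fun a => isLatticeWord_iff_prefixCount.mp hw a x

/-- The entry in the cell `(r, c)` is the length of the shortest prefix with more than `r` letters
`c`. Cells outside the diagram get the value 0 that a semistandard tableau requires. -/
lemma exists_tableau_isColumnWord {w : Fin m → Fin n} (hw : IsLatticeWord w)
    (hk : ∀ a : Fin n, (Finset.univ.filter fun j => w j = a).card = k) (hm : m = k * n) :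
    ∃ T : StandardTableau (rectDiagram n k), IsColumnWord T w := by
  classical
  have hex : ∀ r c, r < k → c < n → ∃ x, r < prefixCount w c x := fun r c hr hc =>
    ⟨m, by rw [prefixCount_length w ⟨c, hc⟩, hk]; exact hr⟩
  have hentry : ∀ r c, ∃ x, (r < k ∧ c < n → ∀ y, x ≤ y ↔ r < prefixCount w c y) ∧
      (¬ (r < k ∧ c < n) → x = 0) := by
    intro r c
    by_cases h : r < k ∧ c < n
    · refine ⟨Nat.find (hex r c h.1 h.2), fun _ y => ⟨fun hy => ?_, fun hy => ?_⟩,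
        fun h' => absurd h h'⟩
      · exact (Nat.find_spec (hex r c h.1 h.2)).trans_le (prefixCount_mono w c hy)
      · exact Nat.find_min' _ hy
    · exact ⟨0, fun h' => absurd h' h, fun _ => rfl⟩
  choose t ht ht0 using hentry
  have hpos : ∀ {r c}, r < k → c < n → 1 ≤ t r c := by
    intro r c hr hc
    by_contra h
    have := (ht r c ⟨hr, hc⟩ 0).mp (by omega)
    rw [prefixCount_zero] at this
    omega
  have hle : ∀ {r c}, r < k → c < n → t r c ≤ m := by
    intro r c hr hc
    rw [ht r c ⟨hr, hc⟩, prefixCount_length w ⟨c, hc⟩, hk]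
    exact hr
  -- the entry `i + 1` is in the cell `(r, c)` if the letter `c` at `i` is preceded by `r` others
  have hcell : ∀ {r c}, r < k → c < n → ∀ i : Fin m, t r c = i + 1 →
      (w i : ℕ) = c ∧ r = prefixCount w (w i) i := by
    intro r c hr hc i hi
    have h1 := (ht r c ⟨hr, hc⟩ (i + 1)).mp hi.le
    have h2 := mt (ht r c ⟨hr, hc⟩ i).mpr (by omega)
    rw [prefixCount_succ] at h1
    split_ifs at h1 with h3
    · rw [h3]
      omega
    · omega
  have hcell' : ∀ i : Fin m, prefixCount w (w i) i < k ∧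
      t (prefixCount w (w i) i) (w i) = i + 1 := by
    intro i
    have h1 := prefixCount_succ w (w i) i
    rw [if_pos rfl] at h1
    have h2 : prefixCount w (w i) i < k := by
      have := prefixCount_mono w (w i) (show (i : ℕ) + 1 ≤ m from i.2)
      rw [prefixCount_length w (w i), hk] at this
      omega
    refine ⟨h2, le_antisymm ?_ ?_⟩
    · rw [ht _ _ ⟨h2, (w i).2⟩]; omega
    · by_contra hcon
      have := (ht _ _ ⟨h2, (w i).2⟩ i).mp (by omega)
      omega
  let T : SemistandardYoungTableau (rectDiagram n k) :=
    { entry := t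
      row_weak' := by
        intro r c c' hcc h
        obtain ⟨hr, hc'⟩ := mem_rectDiagram.mp h
        rw [ht r c ⟨hr, hcc.trans hc'⟩]
        exact ((ht r c' ⟨hr, hc'⟩ _).mp le_rfl).trans_le (prefixCount_antitone hw _ hcc.le)
      col_strict' := by
        intro r r' c hrr h
        obtain ⟨hr', hc⟩ := mem_rectDiagram.mp h
        have h1 := hpos hr' hc
        have h2 := hle hr' hc
        -- The letter that realizes the entry of row `r'` is preceded by `r'` copies of `c`, more
        -- than `r`, so the entry of row `r` is already reached before it.
        have h3 := hcell hr' hc ⟨t r' c - 1, by omega⟩ (by simp only; omega)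
        simp only at h3
        rw [h3.1] at h3
        have h4 := (ht r c ⟨hrr.trans hr', hc⟩ (t r' c - 1)).mpr (by omega)
        omega
      zeros' := by
        intro r c h
        exact ht0 r c (fun h' => h (mem_rectDiagram.mpr h')) }
  refine ⟨⟨T, ?_, ?_, ?_⟩, fun i r c hr hc h => (hcell hr hc i h).1⟩
  · rintro ⟨r, c⟩ hrc
    obtain ⟨hr, hc⟩ : r < k ∧ c < n := mem_coe_cells_rectDiagram.mp hrc
    rw [card_rectDiagram, ← hm, Set.mem_Icc]
    exact ⟨hpos hr hc, hle hr hc⟩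
  · rintro ⟨r, c⟩ hrc ⟨r', c'⟩ hrc' h
    obtain ⟨hr, hc⟩ : r < k ∧ c < n := mem_coe_cells_rectDiagram.mp hrc
    obtain ⟨hr', hc'⟩ : r' < k ∧ c' < n := mem_coe_cells_rectDiagram.mp hrc'
    have h : t r c = t r' c' := h
    have h1 := hpos hr hc
    have h2 := hle hr hc
    obtain ⟨e1, e2⟩ := hcell hr hc ⟨t r c - 1, by omega⟩ (by simp only; omega)
    obtain ⟨e1', e2'⟩ := hcell hr' hc' ⟨t r c - 1, by omega⟩ (by simp only; omega)
    exact Prod.ext (e2.trans e2'.symm) (e1.symm.trans e1')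
  · intro x hx
    rw [card_rectDiagram, ← hm, Set.mem_Icc] at hx
    obtain ⟨h1, h2⟩ := hcell' ⟨x - 1, by omega⟩
    refine ⟨(_, _), mem_coe_cells_rectDiagram.mpr ⟨h1, (w _).2⟩, h2.trans ?_⟩
    simp only
    omega

/-- The bijection which sends a standard tableau of rectangular shape to the word formed by the
columns of its entries. -/
lemma exists_standardTableau_equiv (hm : m = k * n) :
    ∃ Ψ : StandardTableau (rectDiagram n k) ≃ BalancedLatticeWord n k m,
      ∀ (T : StandardTableau (rectDiagram n k)) (i : Fin m) (r c : ℕ),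
        (r, c) ∈ rectDiagram n k → T.1 r c = i + 1 → ((Ψ T).1 i : ℕ) = c := by
  have hex : ∀ T : StandardTableau (rectDiagram n k), ∃ W : BalancedLatticeWord n k m,
      IsColumnWord T W.1 := fun T => by
    obtain ⟨w, hw⟩ := exists_isColumnWord T hm
    exact ⟨⟨w, hw.isLatticeWord hm, hw.card_eq hm⟩, hw⟩
  choose Ψ hΨ using hex
  refine ⟨Equiv.ofBijective Ψ ⟨fun T T' h => ?_, fun W => ?_⟩, fun T i r c hrc => ?_⟩
  · apply Subtype.ext
    ext r c
    by_cases hrc : (r, c) ∈ rectDiagram n k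
    · obtain ⟨hr, hc⟩ := mem_rectDiagram.mp hrc
      refine eq_of_forall_ge_iff fun x => ?_
      rw [(hΨ T).le_iff_lt_prefixCount hm hr hc, (hΨ T').le_iff_lt_prefixCount hm hr hc, h]
    · rw [T.1.zeros hrc, T'.1.zeros hrc]
  · obtain ⟨T, hT⟩ := exists_tableau_isColumnWord W.2.1 W.2.2 hm
    refine ⟨T, Subtype.ext (funext fun i => Fin.ext ?_)⟩
    obtain ⟨r, c, hr, hc, h⟩ := T.exists_cell (x := i) (by have := i.2; omega)
    rw [hΨ T i r c hr hc h, hT i r c hr hc h]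
  · obtain ⟨hr, hc⟩ := mem_rectDiagram.mp hrc
    exact hΨ T i r c hr hc

end Tableaux

/-! ### Counting lattice words by a determinant -/

section Counting

variable {n m : ℕ}

/-- Scaling one row of a matrix entrywise by `d` and summing over the rows. -/
lemma sum_det_updateRow_mul {ι R : Type*} [Fintype ι] [DecidableEq ι] [CommRing R]
    (A : Matrix ι ι R) (d : ι → R) :
    ∑ i, (A.updateRow i fun j => d j * A i j).det = (∑ j, d j) * A.det := by
  have h : ∀ i, (A.updateRow i fun j => d j * A i j).det =
      ∑ σ : Equiv.Perm ι, (Equiv.Perm.sign σ : R) * (d (σ i) * ∏ x, A x (σ x)) := by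
    intro i
    rw [← Matrix.det_transpose, Matrix.det_apply']
    refine Finset.sum_congr rfl fun σ _ => ?_
    congr 1
    rw [← Finset.mul_prod_erase _ _ (Finset.mem_univ i),
      ← Finset.mul_prod_erase _ (fun x => A x (σ x)) (Finset.mem_univ i), ← mul_assoc]
    congr 1
    · simp
    · refine Finset.prod_congr rfl fun x hx => ?_
      rw [Matrix.transpose_apply, Matrix.updateRow_ne (Finset.ne_of_mem_erase hx)]
  simp_rw [h]
  rw [Finset.sum_comm, ← Matrix.det_transpose, Matrix.det_apply', Finset.mul_sum]
  refine Finset.sum_congr rfl fun σ _ => ?_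
  -- For a fixed permutation `σ`, the factors `d (σ i)` sum to `∑ j, d j`.
  rw [← Finset.mul_sum, ← Finset.sum_mul, Equiv.sum_comp σ d]
  simp only [Matrix.transpose_apply]
  ring

lemma sum_det_updateRow_sub_mul {ι R : Type*} [Fintype ι] [DecidableEq ι] [CommRing R]
    (A : Matrix ι ι R) (l d : ι → R) :
    ∑ i, (A.updateRow i fun j => (l i - d j) * A i j).det =
      (∑ i, l i - ∑ j, d j) * A.det := by
  have h : ∀ i, (A.updateRow i fun j => (l i - d j) * A i j).det =
      l i * A.det + (A.updateRow i fun j => -d j * A i j).det := by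
    intro i
    have : (fun j => (l i - d j) * A i j) = l i • A i + fun j => -d j * A i j := by
      ext j
      simp only [Pi.add_apply, Pi.smul_apply, smul_eq_mul]
      ring
    rw [this, Matrix.det_updateRow_add, Matrix.det_updateRow_smul, Matrix.updateRow_eq_self]
  simp_rw [h]
  rw [Finset.sum_add_distrib, sum_det_updateRow_mul, ← Finset.sum_mul, Finset.sum_neg_distrib]
  ring

/-- `1 / (l - j)!`, which is zero if `j > l`. -/
def invFactorialSub (l j : ℕ) : ℚ := l.descFactorial j / l !

/-- With `x = l + 1 - j` this is `x / x! = 1 / (x - 1)!`, which persists for `x ≤ 0` because both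
sides vanish. -/
lemma sub_mul_invFactorialSub_succ (l j : ℕ) :
    (((l + 1 : ℕ) : ℚ) - j) * invFactorialSub (l + 1) j = invFactorialSub l j := by
  rw [invFactorialSub, invFactorialSub]
  have hl : (l ! : ℚ) ≠ 0 := by exact_mod_cast l.factorial_ne_zero
  have hl1 : ((l + 1 : ℕ) : ℚ) ≠ 0 := by exact_mod_cast l.succ_ne_zero
  rcases le_or_gt j (l + 1) with h | h
  · have := Nat.succ_descFactorial l j
    have : (((l + 1 - j : ℕ) : ℚ)) * (l + 1).descFactorial j = (l + 1 : ℕ) * l.descFactorial j := by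
      exact_mod_cast this
    rw [Nat.cast_sub h] at this
    rw [Nat.factorial_succ, Nat.cast_mul, ← mul_div_assoc, this, mul_div_mul_left _ _ hl1]
  · rw [Nat.descFactorial_of_lt h, Nat.descFactorial_of_lt (by omega)]
    simp

lemma neg_mul_invFactorialSub_zero (j : ℕ) :
    (((0 : ℕ) : ℚ) - j) * invFactorialSub 0 j = 0 := by
  rcases j with _ | j <;> simp [invFactorialSub]

lemma invFactorialSub_self (l : ℕ) : invFactorialSub l l = 1 := by
  rw [invFactorialSub, Nat.descFactorial_self, div_self]
  exact_mod_cast l.factorial_ne_zero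

/-- The matrix with the entries `1 / (μ i - i + j)!`. -/
def jacobiTrudiMatrix (μ : Fin n → ℕ) : Matrix (Fin n) (Fin n) ℚ :=
  Matrix.of fun i j => invFactorialSub (μ i + i.rev) j.rev

lemma det_jacobiTrudiMatrix_zero : (jacobiTrudiMatrix (0 : Fin n → ℕ)).det = 1 := by
  rw [Matrix.det_of_isUpperTriangular]
  · refine Finset.prod_eq_one fun i _ => ?_
    simp [jacobiTrudiMatrix, invFactorialSub_self]
  · intro i j hij
    have : (j : ℕ) < i := hij
    have h2 := i.2
    simp only [jacobiTrudiMatrix, Matrix.of_apply, invFactorialSub, Pi.zero_apply, Fin.val_rev]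
    rw [Nat.descFactorial_of_lt (by omega)]
    simp

/-- After reversing rows and columns and pulling `1 / (k + i)!` out of each row, the entries are the
monic falling factorials of degree `j` at `k + i`. They give the Vandermonde determinant of `0, …, n
- 1`, a product of factorials. -/
lemma det_jacobiTrudiMatrix_const (k : ℕ) (hn : 1 ≤ n) :
    (jacobiTrudiMatrix fun _ : Fin n => k).det =
      (∏ i ∈ Finset.Icc 1 (n - 1), (i ! : ℚ)) / ∏ i ∈ Finset.range n, ((k + i)! : ℚ) := by
  obtain ⟨n, rfl⟩ : ∃ p, n = p + 1 := ⟨n - 1, by omega⟩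
  have h1 : (jacobiTrudiMatrix fun _ : Fin (n + 1) => k).det =
      (Matrix.of fun i j : Fin (n + 1) => ((k + i)! : ℚ)⁻¹ *
        (descPochhammer ℚ j).eval ((i : ℚ) + k)).det := by
    rw [← Matrix.det_submatrix_equiv_self Fin.revPerm]
    congr 1
    ext i j
    simp only [jacobiTrudiMatrix, Matrix.submatrix_apply, Matrix.of_apply, Fin.revPerm_apply,
      Fin.rev_rev, invFactorialSub]
    rw [show (i : ℚ) + k = ((k + i : ℕ) : ℚ) by push_cast; ring,
      descPochhammer_eval_eq_descFactorial, div_eq_inv_mul]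
  have h2 := Matrix.det_mul_column (fun i : Fin (n + 1) => ((k + i)! : ℚ)⁻¹)
    (Matrix.of fun i j : Fin (n + 1) => (descPochhammer ℚ j).eval ((i : ℚ) + k))
  simp only [Matrix.of_apply] at h2
  rw [h1, h2, ← Matrix.det_eval_matrixOfPolynomials_eq_det_vandermonde _ _
    (fun i => descPochhammer_natDegree ℚ i) (fun i => monic_descPochhammer ℚ i),
    Matrix.det_vandermonde_add, Matrix.det_vandermonde_id_eq_superFactorial,
    ← Nat.prod_Icc_factorial, Finset.prod_inv_distrib, div_eq_inv_mul, Nat.add_sub_cancel,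
    Fin.prod_univ_eq_prod_range (fun i => ((k + i)! : ℚ))]
  push_cast
  rfl

open Classical in
/-- The lattice words of length `m` in which each letter `a` occurs `μ a` times. -/
noncomputable def latticeWords (m : ℕ) (μ : Fin n → ℕ) : Finset (Fin m → Fin n) :=
  Finset.univ.filter fun w => IsLatticeWord w ∧ ∀ a : Fin n, prefixCount w a m = μ a

lemma mem_latticeWords {μ : Fin n → ℕ} {w : Fin m → Fin n} :
    w ∈ latticeWords m μ ↔ IsLatticeWord w ∧ ∀ a : Fin n, prefixCount w a m = μ a := by
  simp [latticeWords]

lemma prefixCount_init (w : Fin (m + 1) → Fin n) (a : ℕ) {x : ℕ} (hx : x ≤ m) :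
    prefixCount (Fin.init w : Fin m → Fin n) a x = prefixCount w a x := by
  induction x with
  | zero => rw [prefixCount_zero, prefixCount_zero]
  | succ x ih =>
    have h1 := prefixCount_succ (Fin.init w : Fin m → Fin n) a ⟨x, hx⟩
    have h2 := prefixCount_succ w a ⟨x, by omega⟩
    simp only at h1 h2
    rw [h1, h2, ih (by omega)]
    rfl

lemma prefixCount_eq_init_add (w : Fin (m + 1) → Fin n) (a : ℕ) :
    prefixCount w a (m + 1) = prefixCount (Fin.init w : Fin m → Fin n) a m +
      if (w (Fin.last m) : ℕ) = a then 1 else 0 := by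
  rw [prefixCount_init w a le_rfl]
  exact prefixCount_succ w a (Fin.last m)

/-- The only new prefix is the whole word, whose condition is `hμ`. -/
lemma isLatticeWord_iff_init {w : Fin (m + 1) → Fin n} {μ : Fin n → ℕ} (hμ : Antitone μ)
    (hw : ∀ a : Fin n, prefixCount w a (m + 1) = μ a) :
    IsLatticeWord w ↔ IsLatticeWord (Fin.init w : Fin m → Fin n) := by
  rw [isLatticeWord_iff_prefixCount, isLatticeWord_iff_prefixCount]
  constructor
  · intro h a x
    rcases le_total x m with hx | hx
    · rw [prefixCount_init w _ hx, prefixCount_init w _ hx]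
      exact h a x
    · rw [prefixCount_of_length_le _ _ hx, prefixCount_of_length_le _ _ hx,
        prefixCount_init w _ le_rfl, prefixCount_init w _ le_rfl]
      exact h a m
  · intro h a x
    rcases le_or_gt x m with hx | hx
    · rw [← prefixCount_init w _ hx, ← prefixCount_init w _ hx]
      exact h a x
    · rw [prefixCount_of_length_le w _ hx, prefixCount_of_length_le w _ hx]
      by_cases ha : n ≤ a + 1
      · rw [prefixCount_of_le w ha]; omega
      · have h1 := hw ⟨a + 1, by omega⟩
        have h2 := hw ⟨a, by omega⟩
        simp only at h1 h2
        rw [h1, h2]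
        exact hμ (Fin.mk_le_mk.mpr (Nat.le_succ a))

/-- Removing the last letter of the words. -/
lemma card_latticeWords_succ {μ : Fin n → ℕ} (hμ : Antitone μ) :
    (latticeWords (m + 1) μ).card = ∑ a : Fin n, if μ a = 0 then 0 else
      (latticeWords m (Function.update μ a (μ a - 1))).card := by
  rw [Finset.card_eq_sum_card_fiberwise (f := fun w => w (Fin.last m)) (t := Finset.univ)
    (fun _ _ => Finset.mem_coe.mpr (Finset.mem_univ _))]
  refine Finset.sum_congr rfl fun a _ => ?_
  split_ifs with ha
  · rw [Finset.card_eq_zero, Finset.filter_eq_empty_iff]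
    intro w hw hwa
    have := (mem_latticeWords.mp hw).2 a
    rw [prefixCount_eq_init_add, if_pos (by rw [hwa])] at this
    omega
  · refine Finset.card_bij (fun w _ => (Fin.init w : Fin m → Fin n)) ?_ ?_ ?_
    · intro w hw
      obtain ⟨hw, hwa⟩ := Finset.mem_filter.mp hw
      obtain ⟨hw, hc⟩ := mem_latticeWords.mp hw
      refine mem_latticeWords.mpr ⟨(isLatticeWord_iff_init hμ hc).mp hw, fun b => ?_⟩
      have := hc b
      rw [prefixCount_eq_init_add, hwa] at this
      rcases eq_or_ne b a with rfl | hba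
      · rw [if_pos rfl] at this
        rw [Function.update_self]
        omega
      · rw [if_neg (fun h => hba (Fin.ext h).symm)] at this
        rw [Function.update_of_ne hba]
        omega
    · intro w hw w' hw' h
      have h1 := (Finset.mem_filter.mp hw).2
      have h2 := (Finset.mem_filter.mp hw').2
      rw [← Fin.snoc_init_self w, ← Fin.snoc_init_self w', h1, h2]
      exact congrArg (fun v : Fin m → Fin n => (Fin.snoc v a : Fin (m + 1) → Fin n)) h
    · intro w hw
      obtain ⟨hw, hc⟩ := mem_latticeWords.mp hw
      have hinit : (Fin.init (Fin.snoc w a : Fin (m + 1) → Fin n) : Fin m → Fin n) = w :=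
        Fin.init_snoc ..
      have hlast : (Fin.snoc w a : Fin (m + 1) → Fin n) (Fin.last m) = a := Fin.snoc_last ..
      have hc' : ∀ b : Fin n,
          prefixCount (Fin.snoc w a : Fin (m + 1) → Fin n) b (m + 1) = μ b := by
        intro b
        rw [prefixCount_eq_init_add, hinit, hlast, hc b]
        rcases eq_or_ne b a with rfl | hba
        · rw [if_pos rfl, Function.update_self]
          omega
        · rw [if_neg (fun h => hba (Fin.ext h).symm), Function.update_of_ne hba, add_zero]
      refine ⟨Fin.snoc w a, Finset.mem_filter.mpr ⟨mem_latticeWords.mpr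
        ⟨(isLatticeWord_iff_init hμ hc').mpr (hinit.symm ▸ hw), hc'⟩, hlast⟩, hinit⟩

/-- The number of lattice words with content `μ`, that is, the number of standard Young tableaux
with columns of lengths `μ`, by the determinantal form of the hook length formula. -/
theorem card_latticeWords (m : ℕ) (μ : Fin n → ℕ) (hμ : Antitone μ) (hm : ∑ a, μ a = m) :
    ((latticeWords m μ).card : ℚ) = m ! * (jacobiTrudiMatrix μ).det := by
  induction m generalizing μ with
  | zero =>
    have hμ0 : μ = 0 := funext fun a => (Finset.sum_eq_zero_iff.mp hm) a (Finset.mem_univ a)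
    subst hμ0
    have : latticeWords 0 (0 : Fin n → ℕ) = Finset.univ := by
      ext w
      simp only [mem_latticeWords, IsLatticeWord, prefixCount_zero, Finset.mem_univ, iff_true]
      exact ⟨fun i => i.elim0, fun _ => rfl⟩
    rw [this, det_jacobiTrudiMatrix_zero]
    simp
  | succ m ih =>
    have hterm : ∀ a : Fin n, (((if μ a = 0 then 0 else
        (latticeWords m (Function.update μ a (μ a - 1))).card : ℕ)) : ℚ) = m ! *
        ((jacobiTrudiMatrix μ).updateRow a fun j => (((μ a + a.rev : ℕ) : ℚ) - (j.rev : ℕ)) *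
          jacobiTrudiMatrix μ a j).det := by
      intro a
      -- If the next letter `b` has the same multiplicity, removing an `a` violates the lattice
      -- condition at the end of the word; on the other side, the scaled row `a` becomes equal to
      -- row `b`.
      by_cases hA : ∃ b : Fin n, (b : ℕ) = a + 1 ∧ μ b = μ a
      · obtain ⟨b, hba, hμb⟩ := hA
        have hne : a ≠ b := fun h => by rw [h] at hba; omega
        have hdet : ((jacobiTrudiMatrix μ).updateRow a fun j =>
            (((μ a + a.rev : ℕ) : ℚ) - (j.rev : ℕ)) * jacobiTrudiMatrix μ a j).det = 0 := by
          refine Matrix.det_zero_of_row_eq hne ?_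
          rw [Matrix.updateRow_self, Matrix.updateRow_ne hne.symm]
          ext j
          have hl : μ a + (a.rev : ℕ) = (μ b + b.rev) + 1 := by
            have := b.2
            rw [hμb, Fin.val_rev, Fin.val_rev]
            omega
          simp only [jacobiTrudiMatrix, Matrix.of_apply]
          rw [hl, sub_mul_invFactorialSub_succ]
        rw [hdet, mul_zero]
        split_ifs with h0
        · simp
        · rw [Nat.cast_eq_zero, Finset.card_eq_zero, Finset.eq_empty_iff_forall_notMem]
          intro w hw
          obtain ⟨hw, hc⟩ := mem_latticeWords.mp hw
          have h1 := isLatticeWord_iff_prefixCount.mp hw a m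
          rw [← hba, hc b, hc a, Function.update_self, Function.update_of_ne hne.symm, hμb] at h1
          omega
      · push Not at hA
        split_ifs with h0
        -- A letter of multiplicity 0 with no equal successor is the last one, and then the scaled
        -- row is zero.
        · have hlast : (a : ℕ) + 1 = n := by
            by_contra hne
            have hlt : (a : ℕ) + 1 < n := by omega
            have := hμ (show a ≤ ⟨a + 1, hlt⟩ from Fin.le_def.mpr (Nat.le_succ _))
            exact hA ⟨a + 1, hlt⟩ rfl (by omega)
          have hl : μ a + (a.rev : ℕ) = 0 := by rw [h0, Fin.val_rev]; omega
          rw [Matrix.det_eq_zero_of_row_eq_zero a]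
          · simp
          · intro j
            rw [Matrix.updateRow_self]
            simp only [jacobiTrudiMatrix, Matrix.of_apply]
            rw [hl, neg_mul_invFactorialSub_zero]
        -- Otherwise the reduced content is still antitone, and scaling row `a` gives exactly its
        -- matrix.
        · rw [ih]
          · congr 2
            ext i j
            rcases eq_or_ne i a with rfl | hia
            · rw [Matrix.updateRow_self]
              simp only [jacobiTrudiMatrix, Matrix.of_apply, Function.update_self]
              rw [show μ i + (i.rev : ℕ) = (μ i - 1 + i.rev) + 1 by omega,
                sub_mul_invFactorialSub_succ]
            · rw [Matrix.updateRow_ne hia]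
              simp only [jacobiTrudiMatrix, Matrix.of_apply, Function.update_of_ne hia]
          · intro i j hij
            have hle := hμ hij
            rcases eq_or_ne j a with rfl | hja
            · rw [Function.update_self]
              rcases eq_or_ne i j with rfl | hi
              · rw [Function.update_self]
              · rw [Function.update_of_ne hi]; omega
            · rw [Function.update_of_ne hja]
              rcases eq_or_ne i a with rfl | hi
              · rw [Function.update_self]
                have hlt : (i : ℕ) < j := lt_of_le_of_ne hij fun h => hja (Fin.ext h).symm
                have hj := j.2
                have h1 := hμ (show i ≤ ⟨i + 1, by omega⟩ from Fin.le_def.mpr (Nat.le_succ _))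
                have h2 := hA ⟨i + 1, by omega⟩ rfl
                have h3 := hμ (show (⟨i + 1, by omega⟩ : Fin n) ≤ j from Fin.le_def.mpr hlt)
                omega
              · rw [Function.update_of_ne hi]
                exact hle
          · have h1 := Finset.sum_update_of_mem (Finset.mem_univ a) μ (μ a - 1)
            have h2 := Finset.sum_eq_add_sum_sdiff_singleton_of_mem (Finset.mem_univ a) μ
            omega
    rw [card_latticeWords_succ hμ, Nat.cast_sum, Finset.sum_congr rfl fun a _ => hterm a,
      ← Finset.mul_sum, sum_det_updateRow_sub_mul _ (fun i => ((μ i + i.rev : ℕ) : ℚ))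
        (fun j => ((j.rev : ℕ) : ℚ))]
    -- The reversed indices cancel, and the scalar left over turns `m !` into `(m + 1)!`.
    have : ∑ i : Fin n, ((μ i + i.rev : ℕ) : ℚ) - ∑ j : Fin n, ((j.rev : ℕ) : ℚ) =
        ((m + 1 : ℕ) : ℚ) := by
      rw [← hm]
      push_cast
      rw [Finset.sum_add_distrib]
      ring
    rw [this, Nat.factorial_succ]
    push_cast
    ring

lemma card_balancedLatticeWord {n m k : ℕ} (hn : 1 ≤ n) (hm : m = k * n) :
    (Nat.card (BalancedLatticeWord n k m) : ℚ) =
      ((m ! : ℚ) * ∏ i ∈ Finset.Icc 1 (n - 1), (i ! : ℚ)) /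
        ∏ i ∈ Finset.range n, ((k + i)! : ℚ) := by
  have h1 : Nat.card (BalancedLatticeWord n k m) =
      (latticeWords m fun _ : Fin n => k).card := by
    rw [← Nat.card_eq_finsetCard]
    refine Nat.card_congr (Equiv.subtypeEquivRight fun w => ?_)
    rw [mem_latticeWords]
    simp only [prefixCount_length]
  rw [h1, card_latticeWords m _ antitone_const (by simp [hm, mul_comm]),
    det_jacobiTrudiMatrix_const k hn, mul_div_assoc]

end Counting

theorem lemma4 (n m : ℕ) (hn : 1 ≤ n) :
    (Nat.card (WaveGraph n m) ≠ 0 ↔ ∃ k : ℕ, m = k * n) ∧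
    ∀ k : ℕ, m = k * n →
      (Nat.card (WaveGraph n m) : ℚ) =
        ((m ! : ℚ) * ∏ i ∈ Finset.Icc 1 (n - 1), (i ! : ℚ)) /
          ∏ i ∈ Finset.range n, ((k + i)! : ℚ) ∧
      -- the `N`-th vertex of each path of the graph becomes a position of the letter `N`
      (∃ Φ : WaveGraph n m ≃ BalancedLatticeWord n k m,
        ∀ (G : WaveGraph n m) (c : G.1.ConnectedComponent)
          (p : SimpleGraph.pathGraph n ≃g c.toSimpleGraph), IsWave c p →
            ∀ a : Fin n, (Φ G).1 (p a) = a) ∧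
      -- the `i`-th letter is the column of the entry `i` in the tableau
      (∃ Ψ : StandardTableau (rectDiagram n k) ≃ BalancedLatticeWord n k m,
        ∀ (T : StandardTableau (rectDiagram n k)) (i : Fin m) (r c : ℕ),
          (r, c) ∈ rectDiagram n k → T.1 r c = i + 1 → ((Ψ T).1 i : ℕ) = c) := by
  have hcard : ∀ k : ℕ, m = k * n → (Nat.card (WaveGraph n m) : ℚ) =
      ((m ! : ℚ) * ∏ i ∈ Finset.Icc 1 (n - 1), (i ! : ℚ)) /
        ∏ i ∈ Finset.range n, ((k + i)! : ℚ) := fun k hm => by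
    obtain ⟨Φ, -⟩ := exists_waveGraph_equiv hn hm
    rw [Nat.card_congr Φ, card_balancedLatticeWord hn hm]
  refine ⟨⟨fun h => ?_, ?_⟩, fun k hm =>
    ⟨hcard k hm, exists_waveGraph_equiv hn hm, exists_standardTableau_equiv hm⟩⟩
  · obtain ⟨G⟩ := (Nat.card_ne_zero.mp h).1
    exact G.exists_card
  · rintro ⟨k, hm⟩ h
    have := hcard k hm
    rw [h, Nat.cast_zero] at this
    have hpos : (0 : ℚ) < ((m ! : ℚ) * ∏ i ∈ Finset.Icc 1 (n - 1), (i ! : ℚ)) /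
        ∏ i ∈ Finset.range n, ((k + i)! : ℚ) := by positivity
    exact hpos.ne this
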